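/- Conventions. Languages and structures are many-sorted, every sort of a structure is non-empty, and the cardinality of a structure is the total number of its elements in all sorts. A \emph{local language} $\mathcal{L}$ is a relational language with constants together with: for each single sort $s$, a distinguished set $\mathrm{D}^s$ of binary relation symbols on $s$ (the \emph{locality relation symbols}) with the structure of a partially ordered monoid $(\mathrm{D}^s,*,\preceq)$ whose identity is the equality symbol and is also the least element; and, for each pair of constants $c_1,c_2$ of the same sort $s$, a symbol $\mathrm{B}_{c_1,c_2}\in\mathrm{D}^s$. A \emph{local structure} is an $\mathcal{L}$-structure $M$ in which: each $d\in\mathrm{D}^s$ is interpreted as a symmetric relation; $d_1\preceq d_2$ implies $d_1^M\subseteq d_2^M$; $d_1^M\circ d_2^M\subseteq (d_1*d_2)^M$; $\mathrm{B}_{c_1,c_2}(c_1,c_2)$ holds for all constants $c_1,c_2$ of the same sort; and any two elements of the same sort $s$ are related by some $d\in\mathrm{D}^s$. A formula is \emph{positive} if it is built from atomic formulas with $\wedge,\vee,\exists$; a \emph{negative sentence} is the negation of a positive sentence. A \emph{negative local theory} is a set of negative sentences that contains every negative sentence true in all its local models. Let $T$ be a negative local theory in $\mathcal{L}$ which has a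 local model. A local model $M$ of $T$ is \emph{positively closed} (pc) if every homomorphism $f\colon M\to N$ to a local model $N$ of $T$ is a positive embedding, i.e. $N\models\varphi(f(a))$ implies $M\models\varphi(a)$ for every positive formula $\varphi(x)$ and every tuple $a$ in $M$. Two local models $A,B$ of $T$ are \emph{compatible} if there are homomorphisms $A\to M$ and $B\to M$ to a common local model $M$ of $T$; $\mathrm{Com}^{pc}(A)$ denotes the class of pc local models of $T$ compatible with $A$. A \emph{retractor} of $T$ is a local model $R$ of $T$ such that for every homomorphism $f\colon R\to N$ to a local model $N$ of $T$ there is a homomorphism $g\colon N\to R$ with $g\circ f=\mathrm{id}_R$. \textbf{Theorem.} Let $\mathcal{E}=\mathrm{Com}^{pc}(M)$ be the compatibility class of some local positively closed model $M$ of $T$. Then: \begin{enumerate} \item For every $R\in\mathcal{E}$ we have $\mathcal{E}=\mathrm{Com}^{pc}(R)$, and $R$ is a retractor of $T$ if and only if $R$ is homomorphism-universal for $\mathcal{E}$, i.e. for every $N\in\mathcal{E}$ there is a homomorphism $N\to R$. \item Any two retractors of $T$ that belong to $\mathcal{E}$ are isomorphic. \item $\mathcal{E}$ contains a retractor of $T$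 if and only if $\mathcal{E}$ is bounded, i.e. there is a cardinal $\kappa$ such that every element of $\mathcal{E}$ has cardinality at most $\kappa$. \end{enumerate} -/

import Mathlib

universe u

/-! # Many-sorted local languages, local structures and positive formulas -/

/-- `SVar σ s` is the type of the positions of sort `s` in the list of sorts `σ`. It serves both for
the variables of sort `s` of a context `σ` and for the argument places of sort `s` of a symbol of
sort `σ`; thus a tuple of sort `σ` in a sorted set `X` is a map `∀ s, SVar σ s → X s`. -/
inductive SVar {S : Type u} : List S → S → Type u
  | zero {s : S} {σ : List S} : SVar (s :: σ) s
  | succ {s t : S} {σ : List S} : SVar σ s → SVar (t :: σ) s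

/-- Tuples of sort `σ` in the sorted set `X`. -/
abbrev STuple {S : Type u} (X : S → Type u) (σ : List S) : Type u :=
  ∀ s : S, SVar σ s → X s

/-- Extension of a tuple by one element in front. -/
def STuple.cons {S : Type u} {X : S → Type u} {σ : List S} {t : S} (a : X t) (v : STuple X σ) :
    STuple X (t :: σ)
  | _, SVar.zero => a
  | s, SVar.succ x => v s x

/-- A (many-sorted) local language. The symbols are constants, relation symbols and, on each single
sort `s`, the locality relation symbols `Loc s`. The latter are binary relation symbols forming a
partially ordered monoid, whose identity `1` is the equality symbol and is the least element. -/
structure LocalLanguage where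
  /-- single sorts -/
  Srt : Type u
  /-- constant symbols of each sort -/
  Const : Srt → Type u
  /-- relation symbols of each (finite tuple of) sorts, other than the locality relation symbols -/
  Rel : List Srt → Type u
  /-- locality relation symbols on each sort -/
  Loc : Srt → Type u
  [locMonoid : ∀ s, Monoid (Loc s)]
  [locOrder : ∀ s, PartialOrder (Loc s)]
  loc_mul_le_mul : ∀ (s : Srt) (d₁ d₂ e₁ e₂ : Loc s), d₁ ≤ d₂ → e₁ ≤ e₂ → d₁ * e₁ ≤ d₂ * e₂
  loc_one_le : ∀ (s : Srt) (d : Loc s), 1 ≤ d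
  /-- the bound function -/
  bound : ∀ {s : Srt}, Const s → Const s → Loc s

attribute [instance] LocalLanguage.locMonoid LocalLanguage.locOrder

namespace LocalLanguage

/-- An (arbitrary, not necessarily local) `L`-structure. As usual in first-order logic, every sort
is non-empty; the locality symbol `1`, being the equality symbol, is interpreted as equality. -/
structure Str (L : LocalLanguage.{u}) where
  carrier : L.Srt → Type u
  nonempty : ∀ s, Nonempty (carrier s)
  const : ∀ {s : L.Srt}, L.Const s → carrier s
  rel : ∀ {σ : List L.Srt}, L.Rel σ → STuple carrier σ → Prop
  loc : ∀ {s : L.Srt}, L.Loc s → carrier s → carrier s → Prop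
  loc_one : ∀ {s : L.Srt} (a b : carrier s), loc 1 a b ↔ a = b

variable {L : LocalLanguage.{u}}

/-- The locality axioms: an `L`-structure satisfying them is a local structure. -/
structure Str.IsLocal (M : L.Str) : Prop where
  symm : ∀ {s : L.Srt} (d : L.Loc s) (a b : M.carrier s), M.loc d a b → M.loc d b a
  mono : ∀ {s : L.Srt} (d₁ d₂ : L.Loc s), d₁ ≤ d₂ →
    ∀ a b : M.carrier s, M.loc d₁ a b → M.loc d₂ a b
  comp : ∀ {s : L.Srt} (d₁ d₂ : L.Loc s) (a b c : M.carrier s),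
    M.loc d₁ a b → M.loc d₂ b c → M.loc (d₁ * d₂) a c
  bound : ∀ {s : L.Srt} (c₁ c₂ : L.Const s), M.loc (L.bound c₁ c₂) (M.const c₁) (M.const c₂)
  total : ∀ {s : L.Srt} (a b : M.carrier s), ∃ d : L.Loc s, M.loc d a b

/-- The cardinality of a structure: the number of elements in all sorts together. -/
def Str.card (M : L.Str) : Cardinal.{u} := Cardinal.mk (Σ s : L.Srt, M.carrier s)

/-- Homomorphisms of `L`-structures. -/
structure Hom (A B : L.Str) where
  toFun : ∀ s : L.Srt, A.carrier s → B.carrier s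
  map_const : ∀ {s : L.Srt} (c : L.Const s), toFun s (A.const c) = B.const c
  map_rel : ∀ {σ : List L.Srt} (R : L.Rel σ) (a : STuple A.carrier σ),
    A.rel R a → B.rel R (fun s x => toFun s (a s x))
  map_loc : ∀ {s : L.Srt} (d : L.Loc s) (a b : A.carrier s),
    A.loc d a b → B.loc d (toFun s a) (toFun s b)

/-- `IsRetraction f g` : the composite `g ∘ f` is the identity. -/
def IsRetraction {A B : L.Str} (f : Hom A B) (g : Hom B A) : Prop :=
  ∀ (s : L.Srt) (a : A.carrier s), g.toFun s (f.toFun s a) = a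

/-- Two structures are isomorphic if there are mutually inverse homomorphisms between them. -/
def Isomorphic (A B : L.Str) : Prop :=
  ∃ (f : Hom A B) (g : Hom B A), IsRetraction f g ∧ IsRetraction g f

/-- Terms of sort `s` with variables in the context `Γ`: variables and constant symbols. -/
inductive Term (L : LocalLanguage.{u}) (Γ : List L.Srt) (s : L.Srt) : Type u
  | var : SVar Γ s → Term L Γ s
  | const : L.Const s → Term L Γ s

/-- Positive formulas with free variables in the context `Γ`. Equality of terms is the atomic
formula `loc 1 t₁ t₂`. -/
inductive PosFormula (L : LocalLanguage.{u}) : List L.Srt → Type u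
  | loc {Γ : List L.Srt} {s : L.Srt} (d : L.Loc s) (t₁ t₂ : Term L Γ s) : PosFormula L Γ
  | rel {Γ σ : List L.Srt} (R : L.Rel σ) (t : STuple (Term L Γ) σ) : PosFormula L Γ
  | and {Γ : List L.Srt} (φ ψ : PosFormula L Γ) : PosFormula L Γ
  | or {Γ : List L.Srt} (φ ψ : PosFormula L Γ) : PosFormula L Γ
  | ex {Γ : List L.Srt} (s : L.Srt) (φ : PosFormula L (s :: Γ)) : PosFormula L Γ

/-- The value of a term. -/
def Term.eval (M : L.Str) {Γ : List L.Srt} (v : STuple M.carrier Γ) {s : L.Srt} :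
    Term L Γ s → M.carrier s
  | .var x => v s x
  | .const c => M.const c

/-- Satisfaction `M ⊨ φ(v)` of positive formulas. -/
def PosFormula.Realize (M : L.Str) : {Γ : List L.Srt} → PosFormula L Γ → STuple M.carrier Γ → Prop
  | _, .loc d t₁ t₂, v => M.loc d (t₁.eval M v) (t₂.eval M v)
  | _, .rel R t, v => M.rel R (fun s x => (t s x).eval M v)
  | _, .and φ ψ, v => φ.Realize M v ∧ ψ.Realize M v
  | _, .or φ ψ, v => φ.Realize M v ∨ ψ.Realize M v
  | _, .ex s φ, v => ∃ a : M.carrier s, φ.Realize M (STuple.cons a v)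

/-- A negative sentence is the negation of a positive sentence, here called `body`. -/
structure NegSentence (L : LocalLanguage.{u}) where
  body : PosFormula L []

/-- Satisfaction of a negative sentence. -/
def Str.Satisfies (M : L.Str) (χ : NegSentence L) : Prop :=
  ∀ v : STuple M.carrier [], ¬ χ.body.Realize M v

/-- `M` is a local model of the set `T` of negative sentences. -/
def IsLocalModel (T : Set (NegSentence L)) (M : L.Str) : Prop :=
  M.IsLocal ∧ ∀ χ ∈ T, M.Satisfies χ

/-- A negative local theory: a set of negative sentences closed under local implication. -/
def IsNegativeLocalTheory (T : Set (NegSentence L)) : Prop :=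
  ∀ χ : NegSentence L, (∀ M : L.Str, IsLocalModel T M → M.Satisfies χ) → χ ∈ T

/-- `T` has a local model. -/
def LocallySatisfiable (T : Set (NegSentence L)) : Prop :=
  ∃ M : L.Str, IsLocalModel T M

/-- A homomorphism is a positive embedding if it reflects all positive formulas. -/
def Hom.IsPositiveEmbedding {A B : L.Str} (f : Hom A B) : Prop :=
  ∀ (Γ : List L.Srt) (φ : PosFormula L Γ) (a : STuple A.carrier Γ),
    φ.Realize B (fun s x => f.toFun s (a s x)) → φ.Realize A a

/-- `M` is a local positively closed model of `T`. -/
def IsPCModel (T : Set (NegSentence L)) (M : L.Str) : Prop :=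
  IsLocalModel T M ∧
    ∀ N : L.Str, IsLocalModel T N → ∀ f : Hom M N, f.IsPositiveEmbedding

/-- Two structures are compatible in `T` if both map to a common local model of `T`. -/
def Compatible (T : Set (NegSentence L)) (A B : L.Str) : Prop :=
  ∃ M : L.Str, IsLocalModel T M ∧ Nonempty (Hom A M) ∧ Nonempty (Hom B M)

/-- The class of local positively closed models of `T` compatible with `A`. -/
def ComPC (T : Set (NegSentence L)) (A : L.Str) : Set L.Str :=
  {B | IsPCModel T B ∧ Compatible T A B}

/-- `E` is the compatibility class of some local positively closed model of `T`. -/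
def IsCompatibilityClass (T : Set (NegSentence L)) (E : Set L.Str) : Prop :=
  ∃ M : L.Str, IsPCModel T M ∧ E = ComPC T M

/-- A retractor of `T`: a local model of `T` such that every homomorphism from it to a local model
of `T` has a retraction. -/
def IsRetractor (T : Set (NegSentence L)) (R : L.Str) : Prop :=
  IsLocalModel T R ∧
    ∀ N : L.Str, IsLocalModel T N → ∀ f : Hom R N, ∃ g : Hom N R, IsRetraction f g

/-- `R` is (local homomorphism absolutely) universal for the class `E`. -/
def IsUniversalFor (E : Set L.Str) (R : L.Str) : Prop :=
  ∀ N ∈ E, Nonempty (Hom N R)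

/-- The members of `E` are bounded in cardinality. -/
def IsBoundedClass (E : Set L.Str) : Prop :=
  ∃ κ : Cardinal.{u}, ∀ A ∈ E, A.card ≤ κ

end LocalLanguage

/-!
# Retractors in compatibility classes

Homomorphisms out of a positively closed (pc) model are positive embeddings; in particular they are
injective, because equality is a locality symbol. Three constructions carry the argument.

*Amalgamation over pc models* (`IsPCModel.compatible`). Let `f : M → A` and `g : M → B` be
homomorphisms to local models, `M` being pc. Since `f` reflects positive formulas, each positive
formula true of a tuple of `A` can be made true in `B` by a map `A → B` under `M`. The reduced power
of `B` over the set of these maps, along the filter generated by the positive formulas true in `A`,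
receives both `A` and `B`. A reduced power need not be local, but its elements at a finite distance
from the diagonal form a local model, and the image of `A` consists of such elements because every
element of `A` is at a finite distance from `M`. An ultrafilter is not needed: only the implication
of Łoś's theorem from the power to the factors is used, and for positive formulas it holds for every
filter. Consequently compatibility is transitive at pc models (`Compatible.trans`), and the
compatibility classes are equivalence classes.

*Existence of pc models* (`IsLocalModel.exists_hom_isPCModel`). Zorn's lemma is applied to
presentations, that is, structures with a surjection from a set of names, ordered by inclusion of
the names together with homomorphisms respecting them. Unions of chains of presentations exist, and
they preserve local models and pc models. With Henkin-style names, which provide countably many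
fresh names of witnesses for each positive formula with named parameters, a maximal presentation is
pc.

*Bounded classes contain retractors* (`IsBoundedClass.exists_retractor`). If the class is bounded,
Zorn's lemma applied to injectively named members, with more names than the bound, yields a member
`R` such that each homomorphism from `R` to a pc model is surjective, hence an isomorphism. Every
local model maps to a pc one, so `R` is a retractor.

The theorem follows formally. A retractor in the class is universal: map it and a given member to a
common model, and retract. A universal member contains copies of all members, so the class is
bounded, and a retractor `R'` in the class maps to it; a retraction of that map is injective, the
universal member being pc, so the map is an isomorphism (`IsRetractor.exists_inverse`). The same
lemma gives the uniqueness of retractors.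
-/

namespace LocalLanguage

variable {L : LocalLanguage.{u}}

/-! ### Tuples, homomorphisms and positive formulas -/

theorem cons_map {S : Type u} {X Y : S → Type u} (h : ∀ s, X s → Y s) {Γ : List S} {t : S}
    (a : X t) (v : STuple X Γ) :
    (fun s x => h s (STuple.cons a v s x)) = STuple.cons (h t a) (fun s x => h s (v s x)) := by
  funext s x
  cases x <;> rfl

theorem cons_zero_succ {S : Type u} {X : S → Type u} {Γ : List S} {t : S}
    (v : STuple X (t :: Γ)) :
    STuple.cons (v t SVar.zero) (fun s x => v s (SVar.succ x)) = v := by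
  funext s x
  cases x <;> rfl

theorem isEmpty_sVar_nil {S : Type u} (s : S) : IsEmpty (SVar ([] : List S) s) :=
  ⟨fun x => by cases x⟩

/-- A tuple has only finitely many entries. -/
instance finite_sVar {S : Type u} : ∀ Γ : List S, Finite (Σ s, SVar Γ s)
  | [] => by
    have : IsEmpty (Σ s, SVar ([] : List S) s) := ⟨fun p => (isEmpty_sVar_nil p.1).elim p.2⟩
    infer_instance
  | t :: Γ => by
    have := finite_sVar Γ
    refine Finite.of_surjective
      (fun o : Option (Σ s, SVar Γ s) => (o.elim ⟨t, SVar.zero⟩ fun p => ⟨p.1, SVar.succ p.2⟩ :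
        Σ s, SVar (t :: Γ) s)) ?_
    rintro ⟨s, x⟩
    cases x with
    | zero => exact ⟨none, rfl⟩
    | succ y => exact ⟨some ⟨s, y⟩, rfl⟩

theorem PosFormula.Realize.congr {M : L.Str} {Γ : List L.Srt} {φ : PosFormula L Γ}
    {v w : STuple M.carrier Γ} (h : φ.Realize M v) (hvw : ∀ s x, v s x = w s x) :
    φ.Realize M w := by
  have : v = w := by
    funext s x
    exact hvw s x
  rwa [← this]

/-- The identity homomorphism. -/
def Hom.id (A : L.Str) : Hom A A where
  toFun _ a := a
  map_const _ := rfl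
  map_rel _ _ h := h
  map_loc _ _ _ h := h

/-- The composite `g ∘ f` of two homomorphisms. -/
def Hom.comp {A B C : L.Str} (g : Hom B C) (f : Hom A B) : Hom A C where
  toFun s a := g.toFun s (f.toFun s a)
  map_const c := by rw [f.map_const, g.map_const]
  map_rel R a h := g.map_rel R _ (f.map_rel R a h)
  map_loc d a b h := g.map_loc d _ _ (f.map_loc d a b h)

theorem Hom.eval {A B : L.Str} (f : Hom A B) {Γ : List L.Srt} (v : STuple A.carrier Γ) {s : L.Srt}
    (t : Term L Γ s) : t.eval B (fun s x => f.toFun s (v s x)) = f.toFun s (t.eval A v) := by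
  cases t with
  | var x => rfl
  | const c => exact (f.map_const c).symm

/-- Homomorphisms preserve positive formulas. -/
theorem Hom.realize {A B : L.Str} (f : Hom A B) {Γ : List L.Srt} (φ : PosFormula L Γ)
    (v : STuple A.carrier Γ) (h : φ.Realize A v) :
    φ.Realize B (fun s x => f.toFun s (v s x)) := by
  induction φ with
  | loc d t₁ t₂ =>
    simp only [PosFormula.Realize, f.eval] at h ⊢
    exact f.map_loc _ _ _ h
  | rel R t =>
    simp only [PosFormula.Realize, f.eval] at h ⊢
    exact f.map_rel _ _ h
  | and φ ψ ihφ ihψ => exact ⟨ihφ _ h.1, ihψ _ h.2⟩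
  | or φ ψ ihφ ihψ => exact h.imp (ihφ _) (ihψ _)
  | ex s φ ih =>
    obtain ⟨a, ha⟩ := h
    refine ⟨f.toFun s a, ?_⟩
    rw [← cons_map]
    exact ih _ ha

/-- A structure mapping to a local model satisfies the same negative sentences; hence being a local
model is inherited by local structures along homomorphisms. -/
theorem IsLocalModel.of_hom {T : Set (NegSentence L)} {A B : L.Str} (hB : IsLocalModel T B)
    (hA : A.IsLocal) (f : Hom A B) : IsLocalModel T A :=
  ⟨hA, fun χ hχ v hv => hB.2 χ hχ _ (f.realize _ v hv)⟩

theorem Hom.IsPositiveEmbedding.loc {A B : L.Str} {f : Hom A B} (hf : f.IsPositiveEmbedding)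
    {s : L.Srt} (d : L.Loc s) (a b : A.carrier s)
    (h : B.loc d (f.toFun s a) (f.toFun s b)) : A.loc d a b := by
  exact hf [s, s] (.loc d (.var .zero) (.var (.succ .zero)))
    (STuple.cons a (STuple.cons b (fun s x => ((isEmpty_sVar_nil s).elim x)))) h

theorem Hom.IsPositiveEmbedding.rel {A B : L.Str} {f : Hom A B} (hf : f.IsPositiveEmbedding)
    {σ : List L.Srt} (R : L.Rel σ) (a : STuple A.carrier σ)
    (h : B.rel R (fun s x => f.toFun s (a s x))) : A.rel R a :=
  hf σ (.rel R fun _ x => .var x) a h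

theorem Hom.IsPositiveEmbedding.injective {A B : L.Str} {f : Hom A B}
    (hf : f.IsPositiveEmbedding) (s : L.Srt) : Function.Injective (f.toFun s) := fun a b h =>
  (A.loc_one a b).1 (hf.loc 1 a b ((B.loc_one _ _).2 h))

/-- A bijective positive embedding is an isomorphism. -/
theorem Hom.IsPositiveEmbedding.exists_inverse {A B : L.Str} {f : Hom A B}
    (hf : f.IsPositiveEmbedding) (hs : ∀ s, Function.Surjective (f.toFun s)) :
    ∃ g : Hom B A, IsRetraction f g ∧ IsRetraction g f := by
  choose g hg using hs
  have hgf : ∀ s a, g s (f.toFun s a) = a := fun s a => hf.injective s (hg s _)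
  refine ⟨⟨g, fun c => ?_, fun R a h => ?_, fun d a b h => ?_⟩, hgf, hg⟩
  · rw [← f.map_const, hgf]
  · refine hf.rel R _ ?_
    simpa only [hg] using h
  · refine hf.loc d _ _ ?_
    simpa only [hg] using h

/-- Renaming of the variables of a term. -/
def Term.rename {Γ Δ : List L.Srt} (r : ∀ s, SVar Γ s → SVar Δ s) {s : L.Srt} :
    Term L Γ s → Term L Δ s
  | .var x => .var (r s x)
  | .const c => .const c

/-- The renaming that acts as `r` on the old variables and fixes the new one. -/
def liftRename {S : Type u} {Γ Δ : List S} (r : ∀ s, SVar Γ s → SVar Δ s) (t : S) :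
    ∀ s, SVar (t :: Γ) s → SVar (t :: Δ) s
  | _, .zero => .zero
  | s, .succ x => .succ (r s x)

/-- Renaming of the free variables of a positive formula. -/
def PosFormula.rename : {Γ Δ : List L.Srt} → (∀ s, SVar Γ s → SVar Δ s) →
    PosFormula L Γ → PosFormula L Δ
  | _, _, r, .loc d t₁ t₂ => .loc d (t₁.rename r) (t₂.rename r)
  | _, _, r, .rel R t => .rel R fun s x => (t s x).rename r
  | _, _, r, .and φ ψ => .and (φ.rename r) (ψ.rename r)
  | _, _, r, .or φ ψ => .or (φ.rename r) (ψ.rename r)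
  | _, _, r, .ex s φ => .ex s (φ.rename (liftRename r s))

theorem Term.eval_rename (M : L.Str) {Γ Δ : List L.Srt} (r : ∀ s, SVar Γ s → SVar Δ s)
    (v : STuple M.carrier Δ) {s : L.Srt} (t : Term L Γ s) :
    (t.rename r).eval M v = t.eval M (fun s x => v s (r s x)) := by
  cases t <;> rfl

theorem PosFormula.realize_rename (M : L.Str) {Γ Δ : List L.Srt} (φ : PosFormula L Γ)
    (r : ∀ s, SVar Γ s → SVar Δ s) (v : STuple M.carrier Δ) :
    (φ.rename r).Realize M v ↔ φ.Realize M (fun s x => v s (r s x)) := by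
  induction φ generalizing Δ with
  | loc d t₁ t₂ => simp only [PosFormula.rename, PosFormula.Realize, Term.eval_rename]
  | rel R t => simp only [PosFormula.rename, PosFormula.Realize, Term.eval_rename]
  | and φ ψ ihφ ihψ => simp only [PosFormula.rename, PosFormula.Realize, ihφ, ihψ]
  | or φ ψ ihφ ihψ => simp only [PosFormula.rename, PosFormula.Realize, ihφ, ihψ]
  | ex s φ ih =>
    simp only [PosFormula.rename, PosFormula.Realize, ih]
    refine exists_congr fun a => ?_
    have : (fun t x => STuple.cons a v t (liftRename r s t x)) =
        STuple.cons a (fun t x => v t (r t x)) := by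
      funext t x
      cases x <;> rfl
    rw [this]

/-- Concatenation of tuples. -/
def append {S : Type u} {X : S → Type u} : {Γ Δ : List S} → STuple X Γ → STuple X Δ →
    STuple X (Γ ++ Δ)
  | [], _, _, w => w
  | t :: _, _, v, w => STuple.cons (v t .zero) (append (fun s x => v s (.succ x)) w)

/-- A variable of the first context as a variable of the concatenated context. -/
def inlVar {S : Type u} (Δ : List S) : {Γ : List S} → (s : S) → SVar Γ s → SVar (Γ ++ Δ) s
  | _, _, .zero => .zero
  | _, s, .succ x => .succ (inlVar Δ s x)

/-- A variable of the second context as a variable of the concatenated context. -/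
def inrVar {S : Type u} {Δ : List S} : (Γ : List S) → (s : S) → SVar Δ s → SVar (Γ ++ Δ) s
  | [], _, x => x
  | _ :: Γ, s, x => .succ (inrVar Γ s x)

theorem append_inlVar {S : Type u} {X : S → Type u} {Γ Δ : List S} (v : STuple X Γ)
    (w : STuple X Δ) (s : S) (x : SVar Γ s) : append v w s (inlVar Δ s x) = v s x := by
  induction x with
  | zero => rfl
  | succ x ih => exact ih (fun s x => v s (.succ x))

theorem append_inrVar {S : Type u} {X : S → Type u} {Γ Δ : List S} (v : STuple X Γ)
    (w : STuple X Δ) (s : S) (x : SVar Δ s) : append v w s (inrVar Γ s x) = w s x := by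
  induction Γ with
  | nil => rfl
  | cons t Γ ih => exact ih (fun s x => v s (.succ x))

/-- Existential quantification of all the variables of a context. -/
def PosFormula.exs : (Γ : List L.Srt) → {Δ : List L.Srt} → PosFormula L (Γ ++ Δ) → PosFormula L Δ
  | [], _, φ => φ
  | s :: Γ, _, φ => PosFormula.exs Γ (.ex s φ)

theorem PosFormula.realize_exs (M : L.Str) (Γ : List L.Srt) {Δ : List L.Srt}
    (φ : PosFormula L (Γ ++ Δ)) (w : STuple M.carrier Δ) :
    (φ.exs Γ).Realize M w ↔ ∃ v : STuple M.carrier Γ, φ.Realize M (append v w) := by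
  induction Γ with
  | nil => exact ⟨fun h => ⟨fun s x => (isEmpty_sVar_nil s).elim x, h⟩, fun ⟨_, h⟩ => h⟩
  | cons t Γ ih =>
    refine (ih (.ex t φ)).trans ⟨?_, ?_⟩
    · rintro ⟨v, a, h⟩
      exact ⟨STuple.cons a v, h⟩
    · rintro ⟨v, h⟩
      exact ⟨fun s x => v s (.succ x), v t .zero, h⟩

/-! ### Bounded reduced powers -/

/-- The sequences in the sort `s` of `B` which, up to the filter `l`, stay at a fixed distance from
a constant sequence. -/
def BddSeq (B : L.Str) {I : Type u} (l : Filter I) (s : L.Srt) : Type u :=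
  {x : I → B.carrier s // ∃ (b : B.carrier s) (d : L.Loc s), ∀ᶠ i in l, B.loc d (x i) b}

/-- Equality of bounded sequences up to the filter. -/
def bddSeqSetoid (B : L.Str) {I : Type u} (l : Filter I) (s : L.Srt) :
    Setoid (BddSeq B l s) where
  r x y := ∀ᶠ i in l, x.1 i = y.1 i
  iseqv := ⟨fun _ => .of_forall fun _ => rfl, fun h => h.mono fun _ => Eq.symm,
    fun h h' => by filter_upwards [h, h'] with i using Eq.trans⟩

/-- The constant sequences. -/
def BddSeq.const {B : L.Str} {I : Type u} (l : Filter I) {s : L.Srt} (b : B.carrier s) :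
    BddSeq B l s :=
  ⟨fun _ => b, b, 1, .of_forall fun _ => (B.loc_one b b).2 rfl⟩

/-- A representative of a class of bounded sequences. -/
noncomputable def bddRep {B : L.Str} {I : Type u} {l : Filter I} {s : L.Srt}
    (a : Quotient (bddSeqSetoid B l s)) : I → B.carrier s :=
  a.out.1

theorem bddRep_mk {B : L.Str} {I : Type u} {l : Filter I} {s : L.Srt} (x : BddSeq B l s) :
    ∀ᶠ i in l, bddRep (Quotient.mk (bddSeqSetoid B l s) x) i = x.1 i :=
  Quotient.mk_out (s := bddSeqSetoid B l s) x

theorem bddRep_eq {B : L.Str} {I : Type u} {l : Filter I} {s : L.Srt}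
    {a b : Quotient (bddSeqSetoid B l s)} : (∀ᶠ i in l, bddRep a i = bddRep b i) ↔ a = b :=
  Quotient.out_equiv_out (s := bddSeqSetoid B l s)

/-- The bounded reduced power of `B` along the filter `l`: the substructure of the reduced power
consisting of the elements at a finite distance from the diagonal. Passing to it restores the
axiom that any two elements are related by a locality symbol. -/
noncomputable def bddPower (B : L.Str) {I : Type u} (l : Filter I) : L.Str where
  carrier s := Quotient (bddSeqSetoid B l s)
  nonempty s := (B.nonempty s).map fun b => Quotient.mk _ (.const l b)
  const c := Quotient.mk _ (.const l (B.const c))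
  rel R a := ∀ᶠ i in l, B.rel R fun s x => bddRep (a s x) i
  loc d a b := ∀ᶠ i in l, B.loc d (bddRep a i) (bddRep b i)
  loc_one a b := by simp only [B.loc_one, bddRep_eq]

theorem eventually_tuple {S I : Type u} {l : Filter I} {Γ : List S}
    {p : ∀ s, SVar Γ s → I → Prop} (h : ∀ s x, ∀ᶠ i in l, p s x i) :
    ∀ᶠ i in l, ∀ s x, p s x i := by
  have := (Filter.eventually_all (ι := Σ s, SVar Γ s) (l := l) (p := fun y i => p y.1 y.2 i)).2
    fun y => h y.1 y.2
  exact this.mono fun i hi s x => hi ⟨s, x⟩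

/-- The half of Łoś's theorem that holds for every filter: a positive formula true in the bounded
reduced power is true at almost all coordinates. -/
theorem eventually_realize_of_bddPower {B : L.Str} {I : Type u} {l : Filter I} {Γ : List L.Srt}
    (φ : PosFormula L Γ) (v : STuple (bddPower B l).carrier Γ) (h : φ.Realize (bddPower B l) v) :
    ∀ᶠ i in l, φ.Realize B fun s x => bddRep (v s x) i := by
  have eval : ∀ {Γ : List L.Srt} (v : STuple (bddPower B l).carrier Γ) {s : L.Srt}
      (t : Term L Γ s),
      ∀ᶠ i in l, bddRep (t.eval (bddPower B l) v) i = t.eval B fun s x => bddRep (v s x) i := by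
    intro Γ v s t
    cases t with
    | var x => exact .of_forall fun _ => rfl
    | const c => exact bddRep_mk (.const l (B.const c))
  induction φ with
  | loc d t₁ t₂ =>
    filter_upwards [h, eval v t₁, eval v t₂] with i hi h₁ h₂
    simpa only [PosFormula.Realize, h₁, h₂] using hi
  | rel R t =>
    filter_upwards [h, eventually_tuple fun s x => eval v (t s x)] with i hi h₁
    simpa only [PosFormula.Realize, h₁] using hi
  | and φ ψ ihφ ihψ => exact (ihφ v h.1).and (ihψ v h.2)
  | or φ ψ ihφ ihψ =>
    rcases h with h | h
    · exact (ihφ v h).mono fun _ => Or.inl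
    · exact (ihψ v h).mono fun _ => Or.inr
  | ex s φ ih =>
    obtain ⟨a, ha⟩ := h
    filter_upwards [ih _ ha] with i hi
    refine ⟨bddRep a i, ?_⟩
    rwa [← cons_map (fun s (b : (bddPower B l).carrier s) => bddRep b i)]

theorem isLocal_bddPower {B : L.Str} (hB : B.IsLocal) {I : Type u} (l : Filter I) :
    (bddPower B l).IsLocal where
  symm d a b h := h.mono fun _ => hB.symm d _ _
  mono d e hde a b h := h.mono fun _ => hB.mono d e hde _ _
  comp d e a b c h h' := by filter_upwards [h, h'] with i using hB.comp d e _ _ _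
  bound {s} c₁ c₂ := by
    filter_upwards [bddRep_mk (.const l (B.const c₁)), bddRep_mk (.const l (B.const c₂))]
      with i h₁ h₂
    have := hB.bound c₁ c₂
    rw [← show _ = B.const c₁ from h₁, ← show _ = B.const c₂ from h₂] at this
    exact this
  total {s} a b := by
    obtain ⟨p, d, hp⟩ := a.out.2
    obtain ⟨q, e, hq⟩ := b.out.2
    obtain ⟨k, hk⟩ := hB.total p q
    refine ⟨d * k * e, ?_⟩
    filter_upwards [hp, hq] with i h₁ h₂
    exact hB.comp _ _ _ _ _ (hB.comp _ _ _ _ _ h₁ hk) (hB.symm _ _ _ h₂)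

theorem IsLocalModel.bddPower {T : Set (NegSentence L)} {B : L.Str} (hB : IsLocalModel T B)
    {I : Type u} (l : Filter I) [l.NeBot] : IsLocalModel T (bddPower B l) := by
  refine ⟨isLocal_bddPower hB.1 l, fun χ hχ v hv => ?_⟩
  obtain ⟨i, hi⟩ := (eventually_realize_of_bddPower χ.body v hv).exists
  exact hB.2 χ hχ _ hi

/-- The diagonal homomorphism. -/
noncomputable def diagHom (B : L.Str) {I : Type u} (l : Filter I) : Hom B (bddPower B l) where
  toFun _ b := Quotient.mk _ (.const l b)
  map_const _ := rfl
  map_rel R a h := by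
    filter_upwards [eventually_tuple
      fun s x => bddRep_mk (.const l (a s x))] with i hi
    simp only [hi]
    exact h
  map_loc d a b h := by
    filter_upwards [bddRep_mk (.const l a), bddRep_mk (.const l b)] with i h₁ h₂
    rw [h₁, h₂]
    exact h

/-! ### Amalgamation over positively closed models -/

/-- The entries of a tuple in `A` are split into those coming from `M` along `f` and pairwise
distinct ones outside the image of `f`. -/
theorem exists_split {M A : L.Str} (f : Hom M A) {Γ : List L.Srt} (a : STuple A.carrier Γ) :
    ∃ (Γ' Δ : List L.Srt) (a' : STuple A.carrier Γ') (m : STuple M.carrier Δ)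
      (r : ∀ s, SVar Γ s → SVar Γ' s ⊕ SVar Δ s),
      (∀ s, Function.Injective (a' s)) ∧ (∀ s x y, f.toFun s y ≠ a' s x) ∧
      ∀ s x, a s x = Sum.elim (a' s) (fun y => f.toFun s (m s y)) (r s x) := by
  classical
  induction Γ with
  | nil =>
    exact ⟨[], [], a, fun s x => (isEmpty_sVar_nil s).elim x, fun s => Sum.inl,
      fun s x => (isEmpty_sVar_nil s).elim x, fun s x => (isEmpty_sVar_nil s).elim x,
      fun s x => (isEmpty_sVar_nil s).elim x⟩
  | cons t Γ ih =>
    obtain ⟨Γ', Δ, a', m, r, hinj, hf, hr⟩ := ih fun s x => a s (.succ x)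
    by_cases h₁ : ∃ y, f.toFun t y = a t .zero
    · obtain ⟨y, hy⟩ := h₁
      refine ⟨Γ', t :: Δ, a', STuple.cons y m, fun
        | _, .zero => .inr .zero
        | s, .succ x => (r s x).map _root_.id SVar.succ, hinj, hf, ?_⟩
      intro s x
      cases x with
      | zero => exact hy.symm
      | succ x =>
        refine (hr s x).trans ?_
        show _ = Sum.elim _ _ ((r s x).map _root_.id SVar.succ)
        cases r s x <;> rfl
    by_cases h₂ : ∃ x, a' t x = a t .zero
    · obtain ⟨y, hy⟩ := h₂
      refine ⟨Γ', Δ, a', m, fun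
        | _, .zero => .inl y
        | s, .succ x => r s x, hinj, hf, ?_⟩
      intro s x
      cases x with
      | zero => exact hy.symm
      | succ x => exact hr s x
    · push Not at h₁ h₂
      refine ⟨t :: Γ', Δ, STuple.cons (a t .zero) a', m, fun
        | _, .zero => .inl .zero
        | s, .succ x => (r s x).map SVar.succ _root_.id, ?_, ?_, ?_⟩
      · intro s x y hxy
        cases x with
        | zero =>
          cases y with
          | zero => rfl
          | succ y => exact (h₂ y hxy.symm).elim
        | succ x =>
          cases y with
          | zero => exact (h₂ x hxy).elim
          | succ y => exact congrArg SVar.succ (hinj s hxy)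
      · intro s x y
        cases x with
        | zero => exact h₁ y
        | succ x => exact hf s x y
      · intro s x
        cases x with
        | zero => rfl
        | succ x =>
          refine (hr s x).trans ?_
          show _ = Sum.elim _ _ ((r s x).map SVar.succ _root_.id)
          cases r s x <;> rfl

/-- Since `f` reflects positive formulas, finitely many elements of `A` satisfying a positive
formula can be sent to `B`, in a way compatible with `f` and `g`, so that the formula holds. -/
theorem exists_map_realize {M A B : L.Str} {f : Hom M A} (hf : f.IsPositiveEmbedding)
    (g : Hom M B) {Γ : List L.Srt} (φ : PosFormula L Γ) (a : STuple A.carrier Γ)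
    (h : φ.Realize A a) :
    ∃ k : ∀ s, A.carrier s → B.carrier s, (∀ s m, k s (f.toFun s m) = g.toFun s m) ∧
      φ.Realize B fun s x => k s (a s x) := by
  classical
  obtain ⟨Γ', Δ, a', m, r, hinj, hfa, hr⟩ := exists_split f a
  have key : ∀ {N : L.Str} (b : STuple N.carrier Γ') (n : STuple N.carrier Δ),
      (φ.rename fun s x => Sum.elim (inlVar Δ s) (inrVar Γ' s) (r s x)).Realize N (append b n) ↔
        φ.Realize N fun s x => Sum.elim (b s) (n s) (r s x) := by
    intro N b n
    rw [PosFormula.realize_rename]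
    refine iff_of_eq (congrArg _ ?_)
    funext s x
    cases r s x with
    | inl y => exact append_inlVar b n s y
    | inr y => exact append_inrVar b n s y
  have hA := (PosFormula.realize_exs A Γ' _ (fun s y => f.toFun s (m s y))).2 ⟨a', (key _ _).2 (h.congr hr)⟩
  obtain ⟨b, hb⟩ := (PosFormula.realize_exs B Γ' _ _).1 (g.realize _ _ (hf _ _ _ hA))
  rw [key] at hb
  -- A sorted map prescribed by `g` on the image of `f` and by `b` on the entries of `a'`: these two
  -- prescriptions never meet.
  have hk : ∀ s (α : A.carrier s), ∃ β : B.carrier s,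
      (∀ m, f.toFun s m = α → g.toFun s m = β) ∧ (∀ x, a' s x = α → b s x = β) := by
    intro s α
    by_cases h₁ : ∃ m, f.toFun s m = α
    · obtain ⟨m, rfl⟩ := h₁
      exact ⟨g.toFun s m, fun m' hm' => congrArg _ (hf.injective s hm'),
        fun x hx => (hfa s x m hx.symm).elim⟩
    · by_cases h₂ : ∃ x, a' s x = α
      · obtain ⟨x, rfl⟩ := h₂
        exact ⟨b s x, fun m hm => (h₁ ⟨m, hm⟩).elim, fun y hy => congrArg _ (hinj s hy)⟩
      · obtain ⟨β⟩ := B.nonempty s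
        exact ⟨β, fun m hm => (h₁ ⟨m, hm⟩).elim, fun x hx => (h₂ ⟨x, hx⟩).elim⟩
  choose k hkm hka using hk
  refine ⟨k, fun s m => (hkm s _ m rfl).symm, ?_⟩
  refine hb.congr fun s x => ?_
  rw [hr s x]
  cases r s x with
  | inl y => exact hka s _ y rfl
  | inr y => exact hkm s _ _ rfl

/-- Amalgamation: two local models into which a positively closed model maps are compatible. The
common extension is a bounded reduced power of `B`; its index set consists of the sorted maps
`A → B` under `M`, and the filter makes every positive formula true in `A` true eventually. -/
theorem IsPCModel.compatible {T : Set (NegSentence L)} {M A B : L.Str} (hM : IsPCModel T M)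
    (hA : IsLocalModel T A) (hB : IsLocalModel T B) (f : Hom M A) (g : Hom M B) :
    Compatible T A B := by
  have hf := hM.2 A hA f
  let I : Type u := {k : ∀ s, A.carrier s → B.carrier s // ∀ s m, k s (f.toFun s m) = g.toFun s m}
  let D : Type u := {p : Σ Γ : List L.Srt, PosFormula L Γ × STuple A.carrier Γ //
    p.2.1.Realize A p.2.2}
  let U : D → Set I := fun p => {k | p.1.2.1.Realize B fun s x => k.1 s (p.1.2.2 s x)}
  let l : Filter I := ⨅ p, Filter.principal (U p)
  -- There may be no positive formulas at all, so that this does not follow from the filter basis.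
  have hI : Nonempty I := by
    classical
    have hk : ∀ s (α : A.carrier s), ∃ β : B.carrier s, ∀ m, f.toFun s m = α → g.toFun s m = β := by
      intro s α
      by_cases h₁ : ∃ m, f.toFun s m = α
      · obtain ⟨m, rfl⟩ := h₁
        exact ⟨g.toFun s m, fun m' hm' => congrArg _ (hf.injective s hm')⟩
      · obtain ⟨β⟩ := B.nonempty s
        exact ⟨β, fun m hm => (h₁ ⟨m, hm⟩).elim⟩
    choose k hk using hk
    exact ⟨⟨k, fun s m => (hk s _ m rfl).symm⟩⟩
  have hl : l.NeBot := by
    refine Filter.iInf_neBot_of_directed ?_ ?_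
    · rintro ⟨⟨Γ, φ, a⟩, h⟩ ⟨⟨Δ, ψ, b⟩, h'⟩
      have hl : (fun s x => append a b s (inlVar Δ s x)) = a := by
        funext s x
        exact append_inlVar a b s x
      have hr : (fun s x => append a b s (inrVar Γ s x)) = b := by
        funext s x
        exact append_inrVar a b s x
      refine ⟨⟨⟨Γ ++ Δ, .and (φ.rename (inlVar Δ)) (ψ.rename (inrVar Γ)), append a b⟩,
        (PosFormula.realize_rename A φ _ _).2 (by rwa [hl]),
        (PosFormula.realize_rename A ψ _ _).2 (by rwa [hr])⟩, ?_, ?_⟩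
      · refine Filter.principal_mono.2 fun k hk => ?_
        have := (PosFormula.realize_rename B φ _ _).1 hk.1
        simp only [append_inlVar] at this
        exact this
      · refine Filter.principal_mono.2 fun k hk => ?_
        have := (PosFormula.realize_rename B ψ _ _).1 hk.2
        simp only [append_inrVar] at this
        exact this
    · rintro ⟨⟨Γ, φ, a⟩, h⟩
      obtain ⟨k, hk, hk'⟩ := exists_map_realize hf g φ a h
      exact Filter.principal_neBot_iff.2 ⟨⟨k, hk⟩, hk'⟩
  have ev : ∀ {Γ : List L.Srt} (φ : PosFormula L Γ) (a : STuple A.carrier Γ), φ.Realize A a →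
      ∀ᶠ k : I in l, φ.Realize B fun s x => k.1 s (a s x) := fun {Γ} φ a h =>
    Filter.mem_iInf_of_mem (⟨⟨Γ, φ, a⟩, h⟩ : D) (Filter.mem_principal_self _)
  have evl : ∀ {s : L.Srt} (d : L.Loc s) (a b : A.carrier s), A.loc d a b →
      ∀ᶠ k : I in l, B.loc d (k.1 s a) (k.1 s b) := fun {s} d a b h =>
    ev (.loc d (.var .zero) (.var (.succ .zero)))
      (STuple.cons a (STuple.cons b fun s x => (isEmpty_sVar_nil s).elim x) :
        STuple A.carrier [s, s]) h
  -- An element of `A` lies at some distance `d` from an element of `M`, and eventually so does its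
  -- image in `B`; so its images form a bounded sequence.
  let j : ∀ s, A.carrier s → BddSeq B l s := fun s a => ⟨fun k => k.1 s a, by
    obtain ⟨m⟩ := M.nonempty s
    obtain ⟨d, hd⟩ := hA.1.total a (f.toFun s m)
    refine ⟨g.toFun s m, d, (evl d _ _ hd).mono fun k hk => ?_⟩
    rwa [k.2 s m] at hk⟩
  refine ⟨bddPower B l, hB.bddPower l,
    ⟨⟨fun s a => Quotient.mk _ (j s a), fun c => ?_, fun R a h => ?_, fun d a b h => ?_⟩⟩,
    ⟨diagHom B l⟩⟩
  · refine congrArg (Quotient.mk _) (Subtype.ext (funext fun k => ?_))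
    show k.1 _ (A.const c) = B.const c
    rw [← f.map_const, k.2, g.map_const]
  · filter_upwards [eventually_tuple fun s x => bddRep_mk (j s (a s x)),
      ev (.rel R fun _ x => .var x) a h] with k h₁ h₂
    simp only [h₁]
    exact h₂
  · filter_upwards [bddRep_mk (j _ a), bddRep_mk (j _ b), evl d a b h] with k h₁ h₂ h₃
    rw [h₁, h₂]
    exact h₃

theorem Compatible.symm {T : Set (NegSentence L)} {A B : L.Str} :
    Compatible T A B → Compatible T B A := fun ⟨M, hM, f, g⟩ => ⟨M, hM, g, f⟩

/-- Compatibility is transitive at a positively closed model. -/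
theorem Compatible.trans {T : Set (NegSentence L)} {A B C : L.Str} (hB : IsPCModel T B) :
    Compatible T A B → Compatible T B C → Compatible T A C := by
  rintro ⟨M, hM, ⟨f⟩, ⟨g⟩⟩ ⟨N, hN, ⟨f'⟩, ⟨g'⟩⟩
  obtain ⟨K, hK, ⟨p⟩, ⟨q⟩⟩ := hB.compatible hM hN g f'
  exact ⟨K, hK, ⟨p.comp f⟩, ⟨q.comp g'⟩⟩

/-! ### Presentations of structures and unions of chains -/

/-- A structure presented by a sorted set of names: `dom` is the set of names in use and `π` sends
a name to the element it denotes (with irrelevant values outside `dom`). -/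
structure Pres (Ω : L.Srt → Type u) where
  /-- the presented structure -/
  N : L.Str
  /-- the names in use -/
  dom : ∀ s, Set (Ω s)
  /-- the element denoted by a name -/
  π : ∀ s, Ω s → N.carrier s
  /-- every element has a name in use -/
  surj : ∀ s n, ∃ x ∈ dom s, π s x = n

variable {Ω : L.Srt → Type u}

/-- A homomorphism of the presented structures respecting the names. -/
def Pres.Compat (P Q : Pres Ω) (h : Hom P.N Q.N) : Prop :=
  ∀ s, ∀ x ∈ P.dom s, h.toFun s (P.π s x) = Q.π s x

/-- `Q` extends `P`: every name in use in `P` is in use in `Q`, and there is a homomorphism of the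
presented structures respecting the names. -/
def Pres.LE (P Q : Pres Ω) : Prop :=
  (∀ s, P.dom s ⊆ Q.dom s) ∧ ∃ h : Hom P.N Q.N, P.Compat Q h

theorem Pres.LE.refl (P : Pres Ω) : P.LE P := ⟨fun _ => subset_rfl, Hom.id _, fun _ _ _ => rfl⟩

theorem Pres.LE.trans {P Q R : Pres Ω} : P.LE Q → Q.LE R → P.LE R := by
  rintro ⟨h, f, hf⟩ ⟨h', g, hg⟩
  refine ⟨fun s => (h s).trans (h' s), g.comp f, fun s x hx => ?_⟩
  rw [← hg s x (h s hx), ← hf s x hx]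
  rfl

theorem Pres.Compat.unique {P Q : Pres Ω} {h k : Hom P.N Q.N} (hh : P.Compat Q h)
    (hk : P.Compat Q k) {s : L.Srt} (n : P.N.carrier s) : h.toFun s n = k.toFun s n := by
  obtain ⟨x, hx, rfl⟩ := P.surj s n
  rw [hh s x hx, hk s x hx]

/-- A nonempty directed family of presentations. -/
structure Pres.Directed (c : Set (Pres Ω)) : Prop where
  nonempty : c.Nonempty
  directed : ∀ P ∈ c, ∀ Q ∈ c, ∃ R ∈ c, P.LE R ∧ Q.LE R

theorem Pres.Directed.of_isChain {c : Set (Pres Ω)} (hc : IsChain Pres.LE c) (h : c.Nonempty) :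
    Pres.Directed c := by
  refine ⟨h, fun P hP Q hQ => ?_⟩
  have : Std.Refl (Pres.LE (Ω := Ω)) := ⟨Pres.LE.refl⟩
  rcases hc.total hP hQ with h | h
  · exact ⟨Q, hQ, h, .refl Q⟩
  · exact ⟨P, hP, .refl P, h⟩

/-- A finite family of requirements, each of which is met by some member of a directed family and
persists in extensions, is met by a single member. -/
theorem Pres.Directed.exists_forall {c : Set (Pres Ω)} (hc : Directed c) {Γ : List L.Srt}
    {p : ∀ s, SVar Γ s → Pres Ω → Prop}
    (hp : ∀ s x, ∃ P ∈ c, p s x P) (mono : ∀ s x, ∀ P ∈ c, ∀ Q ∈ c, P.LE Q → p s x P → p s x Q) :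
    ∃ P ∈ c, ∀ s x, p s x P := by
  induction Γ with
  | nil =>
    obtain ⟨P, hP⟩ := hc.nonempty
    exact ⟨P, hP, fun s x => (isEmpty_sVar_nil s).elim x⟩
  | cons t Γ ih =>
    obtain ⟨P, hP, h⟩ := ih (p := fun s x => p s (.succ x)) (fun s x => hp s _)
      fun s x => mono s _
    obtain ⟨Q, hQ, h'⟩ := hp t .zero
    obtain ⟨R, hR, hPR, hQR⟩ := hc.directed P hP Q hQ
    refine ⟨R, hR, fun s x => ?_⟩
    cases x with
    | zero => exact mono _ _ Q hQ R hR hQR h'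
    | succ x => exact mono _ _ P hP R hR hPR (h s x)

/-- The names in use in some member of the family. -/
def unionDom (c : Set (Pres Ω)) (s : L.Srt) : Set (Ω s) := {x | ∃ P ∈ c, x ∈ P.dom s}

/-- Two names are identified in the union if they denote the same element in some member. -/
def unionSetoid {c : Set (Pres Ω)} (hc : Pres.Directed c) (s : L.Srt) :
    Setoid (unionDom c s) where
  r x y := ∃ P ∈ c, x.1 ∈ P.dom s ∧ y.1 ∈ P.dom s ∧ P.π s x.1 = P.π s y.1
  iseqv := by
    refine ⟨fun x => ?_, ?_, ?_⟩
    · obtain ⟨P, hP, hx⟩ := x.2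
      exact ⟨P, hP, hx, hx, rfl⟩
    · rintro x y ⟨P, hP, hx, hy, h⟩
      exact ⟨P, hP, hy, hx, h.symm⟩
    · rintro x y z ⟨P, hP, hx, hy, h⟩ ⟨Q, hQ, hy', hz, h'⟩
      obtain ⟨R, hR, ⟨hPR, f, hf⟩, ⟨hQR, g, hg⟩⟩ := hc.directed P hP Q hQ
      refine ⟨R, hR, hPR _ hx, hQR _ hz, ?_⟩
      rw [← hf _ _ hx, h, hf _ _ hy, ← hg _ _ hy', h', hg _ _ hz]

/-- The map from a member of the family to the union. -/
noncomputable def unionMap {c : Set (Pres Ω)} (hc : Pres.Directed c) {P : Pres Ω} (hP : P ∈ c)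
    {s : L.Srt} (n : P.N.carrier s) : Quotient (unionSetoid hc s) :=
  Quotient.mk _ ⟨(P.surj s n).choose, P, hP, (P.surj s n).choose_spec.1⟩

theorem unionMap_π {c : Set (Pres Ω)} (hc : Pres.Directed c) {P : Pres Ω} (hP : P ∈ c)
    {s : L.Srt} {x : Ω s} (hx : x ∈ P.dom s) :
    unionMap hc hP (P.π s x) = Quotient.mk (unionSetoid hc s) ⟨x, P, hP, hx⟩ :=
  Quotient.sound (s := unionSetoid hc s) ⟨P, hP, (P.surj s (P.π s x)).choose_spec.1, hx,
    (P.surj s (P.π s x)).choose_spec.2⟩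

theorem unionMap_compat {c : Set (Pres Ω)} (hc : Pres.Directed c) {P Q : Pres Ω} (hP : P ∈ c)
    (hQ : Q ∈ c) (hd : ∀ s, P.dom s ⊆ Q.dom s) {f : Hom P.N Q.N} (hf : P.Compat Q f)
    {s : L.Srt} (n : P.N.carrier s) : unionMap hc hQ (f.toFun s n) = unionMap hc hP n := by
  obtain ⟨x, hx, rfl⟩ := P.surj s n
  rw [hf s x hx, unionMap_π hc hQ (hd s hx), unionMap_π hc hP hx]

theorem exists_unionMap {c : Set (Pres Ω)} (hc : Pres.Directed c) {s : L.Srt}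
    (a : Quotient (unionSetoid hc s)) :
    ∃ (P : Pres Ω) (hP : P ∈ c) (n : P.N.carrier s), unionMap hc hP n = a := by
  induction a using Quotient.inductionOn with
  | h x =>
    obtain ⟨x, P, hP, hx⟩ := x
    exact ⟨P, hP, P.π s x, unionMap_π hc hP hx⟩

/-- `R` is a common extension of `P` and `Q` in which `m` and `n` become equal. -/
def Pres.Agree {P Q : Pres Ω} {s : L.Srt} (m : P.N.carrier s) (n : Q.N.carrier s) (R : Pres Ω) :
    Prop :=
  P.LE R ∧ Q.LE R ∧ ∀ f g, P.Compat R f → Q.Compat R g → f.toFun s m = g.toFun s n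

theorem Pres.Agree.mono {P Q : Pres Ω} {s : L.Srt} {m : P.N.carrier s} {n : Q.N.carrier s}
    {R R' : Pres Ω} (h : Agree m n R) (hR : R.LE R') : Agree m n R' := by
  obtain ⟨hP, hQ, h⟩ := h
  refine ⟨hP.trans hR, hQ.trans hR, fun f g hf hg => ?_⟩
  obtain ⟨hdP, f', hf'⟩ := hP
  obtain ⟨hdQ, g', hg'⟩ := hQ
  obtain ⟨-, k, hk⟩ := hR
  have hkf : P.Compat R' (k.comp f') := fun s x hx => by
    rw [← hk s x (hdP s hx), ← hf' s x hx]
    rfl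
  have hkg : Q.Compat R' (k.comp g') := fun s x hx => by
    rw [← hk s x (hdQ s hx), ← hg' s x hx]
    rfl
  rw [hf.unique hkf, hg.unique hkg]
  exact congrArg (k.toFun s) (h f' g' hf' hg')

/-- Two elements of members of the family that are equal in the union are equal in a common
extension. -/
theorem exists_agree {c : Set (Pres Ω)} (hc : Pres.Directed c) {P Q : Pres Ω}
    (hP : P ∈ c) (hQ : Q ∈ c) {s : L.Srt} {m : P.N.carrier s} {n : Q.N.carrier s}
    (h : unionMap hc hP m = unionMap hc hQ n) : ∃ R ∈ c, Pres.Agree m n R := by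
  obtain ⟨x, hx, rfl⟩ := P.surj s m
  obtain ⟨y, hy, rfl⟩ := Q.surj s n
  rw [unionMap_π hc hP hx, unionMap_π hc hQ hy] at h
  obtain ⟨R, hR, hx', hy', hxy⟩ := Quotient.exact h
  obtain ⟨R₁, hR₁, hPR₁, hQR₁⟩ := hc.directed P hP Q hQ
  obtain ⟨R₂, hR₂, hRR₂, hR₁R₂⟩ := hc.directed R hR R₁ hR₁
  refine ⟨R₂, hR₂, hPR₁.trans hR₁R₂, hQR₁.trans hR₁R₂, fun f g hf hg => ?_⟩
  obtain ⟨-, k, hk⟩ := hRR₂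
  rw [hf s x hx, hg s y hy, ← hk s x hx', ← hk s y hy', show R.π s x = R.π s y from hxy]

/-- Two tuples of members of the family that are equal in the union are equal in a common
extension. -/
theorem exists_agree_tuple {c : Set (Pres Ω)} (hc : Pres.Directed c) {P Q : Pres Ω}
    (hP : P ∈ c) (hQ : Q ∈ c) {Γ : List L.Srt} {a : STuple P.N.carrier Γ}
    {b : STuple Q.N.carrier Γ} (h : ∀ s x, unionMap hc hP (a s x) = unionMap hc hQ (b s x)) :
    ∃ R ∈ c, P.LE R ∧ ∃ f g, P.Compat R f ∧ Q.Compat R g ∧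
      (fun s x => f.toFun s (a s x)) = fun s x => g.toFun s (b s x) := by
  obtain ⟨R₁, hR₁, h₁⟩ := hc.exists_forall (p := fun s x R => Pres.Agree (a s x) (b s x) R)
    (fun s x => exists_agree hc hP hQ (h s x)) fun s x P _ Q _ h h' => h'.mono h
  obtain ⟨R₂, hR₂, hPR₂, hQR₂⟩ := hc.directed P hP Q hQ
  obtain ⟨R, hR, hR₁R, hR₂R⟩ := hc.directed R₁ hR₁ R₂ hR₂
  obtain ⟨-, f, hf⟩ := hPR₂.trans hR₂R
  obtain ⟨-, g, hg⟩ := hQR₂.trans hR₂R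
  refine ⟨R, hR, hPR₂.trans hR₂R, f, g, hf, hg, ?_⟩
  funext s x
  exact ((h₁ s x).mono hR₁R).2.2 f g hf hg

/-- The union of a directed family of presented structures. -/
noncomputable def unionStr {c : Set (Pres Ω)} (hc : Pres.Directed c) : L.Str where
  carrier s := Quotient (unionSetoid hc s)
  nonempty s := by
    obtain ⟨P, hP⟩ := hc.nonempty
    exact (P.N.nonempty s).map (unionMap hc hP)
  const c := unionMap hc hc.nonempty.choose_spec (hc.nonempty.choose.N.const c)
  rel S a := ∃ (P : Pres Ω) (hP : P ∈ c) (b : STuple P.N.carrier _),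
    P.N.rel S b ∧ ∀ s x, unionMap hc hP (b s x) = a s x
  loc d a b := ∃ (P : Pres Ω) (hP : P ∈ c) (m n : P.N.carrier _),
    P.N.loc d m n ∧ unionMap hc hP m = a ∧ unionMap hc hP n = b
  loc_one a b := by
    refine ⟨?_, ?_⟩
    · rintro ⟨P, hP, m, n, h, rfl, rfl⟩
      rw [(P.N.loc_one m n).1 h]
    · rintro rfl
      obtain ⟨P, hP, n, rfl⟩ := exists_unionMap hc a
      exact ⟨P, hP, n, n, (P.N.loc_one n n).2 rfl, rfl, rfl⟩

theorem unionMap_const {c : Set (Pres Ω)} (hc : Pres.Directed c) {P : Pres Ω} (hP : P ∈ c)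
    {s : L.Srt} (k : L.Const s) : unionMap hc hP (P.N.const k) = (unionStr hc).const k := by
  have hQ := hc.nonempty.choose_spec
  obtain ⟨R, hR, ⟨h, f, hf⟩, ⟨h', g, hg⟩⟩ := hc.directed P hP _ hQ
  show _ = unionMap hc hQ _
  rw [← unionMap_compat hc hP hR h hf, ← unionMap_compat hc hQ hR h' hg, f.map_const, g.map_const]

/-- The map from a member of the family to the union, as a homomorphism. -/
noncomputable def unionHom {c : Set (Pres Ω)} (hc : Pres.Directed c) {P : Pres Ω} (hP : P ∈ c) :
    Hom P.N (unionStr hc) where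
  toFun _ n := unionMap hc hP n
  map_const k := unionMap_const hc hP k
  map_rel _ a h := ⟨P, hP, a, h, fun _ _ => rfl⟩
  map_loc _ a b h := ⟨P, hP, a, b, h, rfl, rfl⟩

theorem unionHom_compat {c : Set (Pres Ω)} (hc : Pres.Directed c) {P Q : Pres Ω} (hP : P ∈ c)
    (hQ : Q ∈ c) {f : Hom P.N Q.N} (hPQ : P.LE Q) (hf : P.Compat Q f) {s : L.Srt}
    (n : P.N.carrier s) :
    (unionHom hc hQ).toFun s (f.toFun s n) = (unionHom hc hP).toFun s n :=
  unionMap_compat hc hP hQ hPQ.1 hf n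

/-- Every tuple of the union comes from a member of the family. -/
theorem exists_unionHom_tuple {c : Set (Pres Ω)} (hc : Pres.Directed c) {Γ : List L.Srt}
    (v : STuple (unionStr hc).carrier Γ) :
    ∃ (P : Pres Ω) (hP : P ∈ c) (a : STuple P.N.carrier Γ),
      (fun s x => (unionHom hc hP).toFun s (a s x)) = v := by
  obtain ⟨P, hP, h⟩ := hc.exists_forall
    (p := fun s x P => ∃ (hP : P ∈ c) (n : P.N.carrier s), unionMap hc hP n = v s x)
    (fun s x => by
      obtain ⟨P, hP, n, hn⟩ := exists_unionMap hc (v s x)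
      exact ⟨P, hP, hP, n, hn⟩) (by
      rintro s x P hP Q hQ ⟨hd, f, hf⟩ ⟨_, n, hn⟩
      exact ⟨hQ, f.toFun s n, (unionMap_compat hc hP hQ hd hf n).trans hn⟩)
  choose _ a ha using h
  refine ⟨P, hP, a, ?_⟩
  funext s x
  exact ha s x

/-- A positive formula true in the union is true in a member of the family. -/
theorem exists_realize_of_union {c : Set (Pres Ω)} (hc : Pres.Directed c) {Γ : List L.Srt}
    (φ : PosFormula L Γ) (v : STuple (unionStr hc).carrier Γ) (h : φ.Realize (unionStr hc) v) :
    ∃ (P : Pres Ω) (hP : P ∈ c) (a : STuple P.N.carrier Γ),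
      (fun s x => (unionHom hc hP).toFun s (a s x)) = v ∧ φ.Realize P.N a := by
  induction φ with
  | @loc Γ s d t₁ t₂ =>
    obtain ⟨P, hP, a, rfl⟩ := exists_unionHom_tuple hc v
    obtain ⟨Q, hQ, m, n, hmn, hm, hn⟩ := h
    rw [Hom.eval] at hm hn
    obtain ⟨R₁, hR₁, h₁⟩ := exists_agree hc hQ hP hm
    obtain ⟨R₂, hR₂, h₂⟩ := exists_agree hc hQ hP hn
    obtain ⟨R, hR, hR₁R, hR₂R⟩ := hc.directed R₁ hR₁ R₂ hR₂
    replace h₁ := h₁.mono hR₁R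
    replace h₂ := h₂.mono hR₂R
    have hPR := h₁.2.1
    obtain ⟨-, g, hg⟩ := h₁.1
    obtain ⟨-, f, hf⟩ := h₁.2.1
    refine ⟨R, hR, fun s x => f.toFun s (a s x), ?_, ?_⟩
    · funext s x
      exact unionHom_compat hc hP hR hPR hf _
    · show R.N.loc d _ _
      rw [Hom.eval, Hom.eval, ← h₁.2.2 g f hg hf, ← h₂.2.2 g f hg hf]
      exact g.map_loc d m n hmn
  | @rel Γ σ S t =>
    obtain ⟨P, hP, a, rfl⟩ := exists_unionHom_tuple hc v
    obtain ⟨Q, hQ, b, hb, hba⟩ := h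
    simp only [Hom.eval] at hba
    obtain ⟨R, hR, hPR, f, g, hf, hg, hfg⟩ := exists_agree_tuple hc hP hQ
      (a := fun s x => (t s x).eval P.N a) (b := b) fun s x => (hba s x).symm
    refine ⟨R, hR, fun s x => f.toFun s (a s x), ?_, ?_⟩
    · funext s x
      exact unionHom_compat hc hP hR hPR hf _
    · show R.N.rel S _
      simp only [Hom.eval]
      rw [hfg]
      exact g.map_rel S b hb
  | and φ ψ ihφ ihψ =>
    obtain ⟨P, hP, a, rfl, ha⟩ := ihφ v h.1
    obtain ⟨Q, hQ, b, hb, hb'⟩ := ihψ _ h.2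
    obtain ⟨R, hR, hPR, f, g, hf, hg, hfg⟩ := exists_agree_tuple hc hP hQ
      (a := a) (b := b) fun s x => (congrFun (congrFun hb s) x).symm
    refine ⟨R, hR, fun s x => f.toFun s (a s x), ?_, f.realize φ a ha, ?_⟩
    · funext s x
      exact unionHom_compat hc hP hR hPR hf _
    · rw [hfg]
      exact g.realize ψ b hb'
  | or φ ψ ihφ ihψ =>
    rcases h with h | h
    · obtain ⟨P, hP, a, ha, ha'⟩ := ihφ v h
      exact ⟨P, hP, a, ha, .inl ha'⟩
    · obtain ⟨P, hP, a, ha, ha'⟩ := ihψ v h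
      exact ⟨P, hP, a, ha, .inr ha'⟩
  | ex s φ ih =>
    obtain ⟨u, hu⟩ := h
    obtain ⟨P, hP, a, ha, ha'⟩ := ih _ hu
    refine ⟨P, hP, fun s x => a s (.succ x), ?_, a s .zero, ?_⟩
    · funext s x
      exact congrFun (congrFun ha s) (.succ x)
    · rwa [cons_zero_succ]

theorem isLocal_unionStr {c : Set (Pres Ω)} (hc : Pres.Directed c)
    (h : ∀ P ∈ c, P.N.IsLocal) : (unionStr hc).IsLocal where
  symm d a b := by
    rintro ⟨P, hP, m, n, hmn, rfl, rfl⟩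
    exact ⟨P, hP, n, m, (h P hP).symm d m n hmn, rfl, rfl⟩
  mono d e hde a b := by
    rintro ⟨P, hP, m, n, hmn, rfl, rfl⟩
    exact ⟨P, hP, m, n, (h P hP).mono d e hde m n hmn, rfl, rfl⟩
  comp d e a b k := by
    rintro ⟨P, hP, m, n, hmn, rfl, rfl⟩ ⟨Q, hQ, n', q, hnq, hn, rfl⟩
    obtain ⟨R, hR, ⟨hPR, f, hf⟩, ⟨hQR, g, hg⟩, hfg⟩ := exists_agree hc hP hQ hn.symm
    refine ⟨R, hR, f.toFun _ m, g.toFun _ q, ?_, unionMap_compat hc hP hR hPR hf m,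
      unionMap_compat hc hQ hR hQR hg q⟩
    refine (h R hR).comp d e _ _ _ (f.map_loc d m n hmn) ?_
    rw [hfg f g hf hg]
    exact g.map_loc e n' q hnq
  bound c₁ c₂ := by
    obtain ⟨P, hP⟩ := hc.nonempty
    exact ⟨P, hP, _, _, (h P hP).bound c₁ c₂, unionMap_const hc hP c₁, unionMap_const hc hP c₂⟩
  total a b := by
    obtain ⟨P, hP, m, rfl⟩ := exists_unionMap hc a
    obtain ⟨Q, hQ, n, rfl⟩ := exists_unionMap hc b
    obtain ⟨R, hR, ⟨hPR, f, hf⟩, ⟨hQR, g, hg⟩⟩ := hc.directed P hP Q hQ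
    obtain ⟨d, hd⟩ := (h R hR).total (f.toFun _ m) (g.toFun _ n)
    exact ⟨d, R, hR, _, _, hd, unionMap_compat hc hP hR hPR hf m,
      unionMap_compat hc hQ hR hQR hg n⟩

/-- Directed unions of local models are local models. -/
theorem isLocalModel_unionStr {T : Set (NegSentence L)} {c : Set (Pres Ω)}
    (hc : Pres.Directed c) (h : ∀ P ∈ c, IsLocalModel T P.N) : IsLocalModel T (unionStr hc) := by
  refine ⟨isLocal_unionStr hc fun P hP => (h P hP).1, fun χ hχ v hv => ?_⟩
  obtain ⟨P, hP, a, -, ha⟩ := exists_realize_of_union hc χ.body v hv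
  exact (h P hP).2 χ hχ a ha

/-- Directed unions of positively closed models are positively closed. -/
theorem isPCModel_unionStr {T : Set (NegSentence L)} {c : Set (Pres Ω)}
    (hc : Pres.Directed c) (h : ∀ P ∈ c, IsPCModel T P.N) : IsPCModel T (unionStr hc) := by
  refine ⟨isLocalModel_unionStr hc fun P hP => (h P hP).1, fun N hN f Γ φ v hv => ?_⟩
  obtain ⟨P, hP, a, rfl⟩ := exists_unionHom_tuple hc v
  exact (unionHom hc hP).realize φ a ((h P hP).2 N hN (f.comp (unionHom hc hP)) Γ φ a hv)

/-- The union of a directed family, presented by all names in use in its members. -/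
noncomputable def unionPres {c : Set (Pres Ω)} (hc : Pres.Directed c) : Pres Ω where
  N := unionStr hc
  dom := unionDom c
  π s x := by
    classical
    exact if h : x ∈ unionDom c s then Quotient.mk (unionSetoid hc s) ⟨x, h⟩
      else ((unionStr hc).nonempty s).some
  surj s n := by
    induction n using Quotient.inductionOn with
    | h x => exact ⟨x.1, x.2, dif_pos x.2⟩

theorem unionPres_π {c : Set (Pres Ω)} (hc : Pres.Directed c) {s : L.Srt} {x : Ω s}
    (hx : x ∈ unionDom c s) :
    (unionPres hc).π s x = Quotient.mk (unionSetoid hc s) ⟨x, hx⟩ :=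
  dif_pos hx

theorem unionHom_compat_unionPres {c : Set (Pres Ω)} (hc : Pres.Directed c) {P : Pres Ω}
    (hP : P ∈ c) : P.Compat (unionPres hc) (unionHom hc hP) := fun s x hx => by
  rw [unionPres_π hc ⟨P, hP, hx⟩]
  exact unionMap_π hc hP hx

theorem le_unionPres {c : Set (Pres Ω)} (hc : Pres.Directed c) {P : Pres Ω} (hP : P ∈ c) :
    P.LE (unionPres hc) :=
  ⟨fun _ _ hx => ⟨P, hP, hx⟩, unionHom hc hP, unionHom_compat_unionPres hc hP⟩

/-- Zorn's lemma for a property of presentations that is inherited by unions of chains. -/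
theorem exists_maximal_pres (p : Pres Ω → Prop) (h₀ : ∃ P, p P)
    (hu : ∀ (c : Set (Pres Ω)) (hc : Pres.Directed c), (∀ P ∈ c, p P) → p (unionPres hc)) :
    ∃ P, p P ∧ ∀ Q, p Q → P.LE Q → Q.LE P := by
  obtain ⟨P₀, hP₀⟩ := h₀
  have : Nonempty {P // p P} := ⟨⟨P₀, hP₀⟩⟩
  obtain ⟨P, hP⟩ := exists_maximal_of_nonempty_chains_bounded
    (r := fun P Q : {P // p P} => P.1.LE Q.1) (fun c hc hne => by
      have hd : Pres.Directed (Subtype.val '' c) := .of_isChain (by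
        rintro _ ⟨P, hP, rfl⟩ _ ⟨Q, hQ, rfl⟩ hPQ
        exact hc hP hQ fun h => hPQ (congrArg _ h)) (hne.image _)
      refine ⟨⟨unionPres hd, hu _ hd ?_⟩, fun P hP => le_unionPres hd ⟨P, hP, rfl⟩⟩
      rintro _ ⟨P, -, rfl⟩
      exact P.2) fun h h' => h.trans h'
  exact ⟨P.1, P.2, fun Q hQ => hP ⟨Q, hQ⟩⟩

/-! ### Existence of positively closed models -/

/-- The induced substructure of `N` on a family of sets containing the constants. -/
def Str.induced (N : L.Str) (D : ∀ s, Set (N.carrier s)) (hne : ∀ s, (D s).Nonempty)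
    (hD : ∀ {s : L.Srt} (c : L.Const s), N.const c ∈ D s) : L.Str where
  carrier s := D s
  nonempty s := (hne s).to_subtype
  const c := ⟨N.const c, hD c⟩
  rel R a := N.rel R fun s x => (a s x).1
  loc d a b := N.loc d a.1 b.1
  loc_one _ _ := (N.loc_one _ _).trans Subtype.ext_iff.symm

section Induced

variable {N : L.Str} {D : ∀ s, Set (N.carrier s)} {hne : ∀ s, (D s).Nonempty}
  {hD : ∀ {s : L.Srt} (c : L.Const s), N.const c ∈ D s}

/-- The inclusion of an induced substructure. -/
def Str.inducedHom : Hom (N.induced D hne hD) N where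
  toFun _ a := a.1
  map_const _ := rfl
  map_rel _ _ h := h
  map_loc _ _ _ h := h

theorem IsLocalModel.induced {T : Set (NegSentence L)} (hN : IsLocalModel T N) :
    IsLocalModel T (N.induced D hne hD) :=
  hN.of_hom
    { symm := fun d a b => hN.1.symm d a.1 b.1
      mono := fun d e h a b => hN.1.mono d e h a.1 b.1
      comp := fun d e a b c => hN.1.comp d e a.1 b.1 c.1
      bound := fun c₁ c₂ => hN.1.bound c₁ c₂
      total := fun a b => hN.1.total a.1 b.1 } Str.inducedHom

/-- A homomorphism into `N` with values in `D`, as a homomorphism into the substructure. -/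
def Hom.codRestrict {A : L.Str} (f : Hom A N) (hf : ∀ s a, f.toFun s a ∈ D s) :
    Hom A (N.induced D hne hD) where
  toFun s a := ⟨f.toFun s a, hf s a⟩
  map_const c := Subtype.ext (f.map_const c)
  map_rel R a h := f.map_rel R a h
  map_loc d a b h := f.map_loc d a b h

end Induced

/-- A positive formula true in `N` has countably many witnesses: it stays true in every
substructure containing its parameters and the witnesses. -/
theorem exists_countable_witnesses (N : L.Str) {Γ : List L.Srt} (φ : PosFormula L Γ)
    (v : STuple N.carrier Γ) (h : φ.Realize N v) :
    ∃ W : ∀ s, Set (N.carrier s), (∀ s, (W s).Countable) ∧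
      ∀ (D : ∀ s, Set (N.carrier s)) (hne : ∀ s, (D s).Nonempty)
        (hD : ∀ {s : L.Srt} (c : L.Const s), N.const c ∈ D s) (hv : ∀ s x, v s x ∈ D s),
        (∀ s, W s ⊆ D s) → φ.Realize (N.induced D hne hD) fun s x => ⟨v s x, hv s x⟩ := by
  have eval : ∀ (D : ∀ s, Set (N.carrier s)) (hne : ∀ s, (D s).Nonempty)
      (hD : ∀ {s : L.Srt} (c : L.Const s), N.const c ∈ D s) {Γ : List L.Srt}
      (v : STuple N.carrier Γ) (hv : ∀ s x, v s x ∈ D s) {s : L.Srt} (t : Term L Γ s),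
      (t.eval (N.induced D hne hD) fun s x => ⟨v s x, hv s x⟩).1 = t.eval N v :=
    fun D hne hD {Γ} v hv {s} t =>
      (Hom.eval (Str.inducedHom (N := N) (D := D) (hne := hne) (hD := hD))
        (fun s x => ⟨v s x, hv s x⟩) t).symm
  induction φ with
  | loc d t₁ t₂ =>
    refine ⟨fun _ => ∅, fun _ => Set.countable_empty, fun D hne hD hv _ => ?_⟩
    show N.loc d _ _
    rw [eval, eval]
    exact h
  | rel R t =>
    refine ⟨fun _ => ∅, fun _ => Set.countable_empty, fun D hne hD hv _ => ?_⟩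
    show N.rel R _
    simp only [eval]
    exact h
  | and φ ψ ihφ ihψ =>
    obtain ⟨W, hW, h₁⟩ := ihφ v h.1
    obtain ⟨W', hW', h₂⟩ := ihψ v h.2
    exact ⟨fun s => W s ∪ W' s, fun s => (hW s).union (hW' s), fun D hne hD hv hWD =>
      ⟨h₁ D hne hD hv fun s => Set.subset_union_left.trans (hWD s),
        h₂ D hne hD hv fun s => Set.subset_union_right.trans (hWD s)⟩⟩
  | or φ ψ ihφ ihψ =>
    rcases h with h | h
    · obtain ⟨W, hW, h₁⟩ := ihφ v h
      exact ⟨W, hW, fun D hne hD hv hWD => .inl (h₁ D hne hD hv hWD)⟩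
    · obtain ⟨W, hW, h₁⟩ := ihψ v h
      exact ⟨W, hW, fun D hne hD hv hWD => .inr (h₁ D hne hD hv hWD)⟩
  | ex t φ ih =>
    obtain ⟨a, ha⟩ := h
    obtain ⟨W, hW, h₁⟩ := ih _ ha
    refine ⟨fun s => W s ∪ {x | HEq x a}, fun s => (hW s).union (Set.Subsingleton.countable
      fun x hx y hy => eq_of_heq (HEq.trans hx (HEq.symm hy))), fun D hne hD hv hWD => ?_⟩
    have haD : a ∈ D t := hWD t (.inr HEq.rfl)
    have hv' : ∀ s x, (STuple.cons a v : STuple N.carrier _) s x ∈ D s := by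
      intro s x
      cases x with
      | zero => exact haD
      | succ x => exact hv s x
    refine ⟨⟨a, haD⟩, ?_⟩
    refine (h₁ D hne hD hv' fun s => Set.subset_union_left.trans (hWD s)).congr fun s x => ?_
    cases x <;> rfl

/-- Names for the elements of a positively closed model above `A`: a name for each element of `A`
and, in each sort, countably many names of witnesses for each positive formula with parameters that
are themselves named. -/
inductive Henkin (A : L.Str) : L.Srt → Type u
  | base {s : L.Srt} (a : A.carrier s) : Henkin A s
  | wit {s : L.Srt} {Γ : List L.Srt} (φ : PosFormula L Γ) (c : ∀ t, SVar Γ t → Henkin A t)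
      (n : ℕ) : Henkin A s

/-- The presentations over which Zorn's lemma produces a positively closed model: a local model of
`T` above `A` in which a formula is true as soon as names of witnesses for it are in use. -/
structure IsHenkinPres (T : Set (NegSentence L)) (A : L.Str) (P : Pres (Henkin A)) : Prop where
  model : IsLocalModel T P.N
  base_mem : ∀ s (a : A.carrier s), Henkin.base a ∈ P.dom s
  hom : ∃ h : Hom A P.N, ∀ s a, h.toFun s a = P.π s (.base a)
  wit_mem : ∀ (s : L.Srt) (Γ : List L.Srt) (φ : PosFormula L Γ) (c : STuple (Henkin A) Γ) (n : ℕ),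
    Henkin.wit φ c n ∈ P.dom s →
      (∀ t x, c t x ∈ P.dom t) ∧ φ.Realize P.N fun t x => P.π t (c t x)

theorem isHenkinPres_unionPres {T : Set (NegSentence L)} {A : L.Str} {c : Set (Pres (Henkin A))}
    (hc : Pres.Directed c) (h : ∀ P ∈ c, IsHenkinPres T A P) :
    IsHenkinPres T A (unionPres hc) := by
  obtain ⟨P, hP⟩ := hc.nonempty
  refine ⟨isLocalModel_unionStr hc fun P hP => (h P hP).model,
    fun s a => ⟨P, hP, (h P hP).base_mem s a⟩, ?_, ?_⟩
  · obtain ⟨k, hk⟩ := (h P hP).hom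
    refine ⟨(unionHom hc hP).comp k, fun s a => ?_⟩
    rw [← unionHom_compat_unionPres hc hP s _ ((h P hP).base_mem s a), ← hk]
    rfl
  · rintro s Γ φ k n ⟨Q, hQ, hk⟩
    obtain ⟨h₁, h₂⟩ := (h Q hQ).wit_mem s Γ φ k n hk
    exact ⟨fun t x => ⟨Q, hQ, h₁ t x⟩, ((unionHom hc hQ).realize φ _ h₂).congr fun t x =>
      unionHom_compat_unionPres hc hQ t _ (h₁ t x)⟩

/-- The value of a name for an extension along `f` of the presentation `P`: unchanged if the name
is in use in `P`; otherwise the `n`-th of the given witnesses. (The value at a name of an element of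
`A` that is not in use is irrelevant.) -/
noncomputable def henkinExtend {A N : L.Str} (P : Pres (Henkin A)) (f : Hom P.N N)
    (w : ∀ s, ℕ → N.carrier s) (s : L.Srt) (x : Henkin A s) : N.carrier s := by
  classical
  exact if x ∈ P.dom s then f.toFun s (P.π s x) else
    match x with
    | .base _ => f.toFun s (P.π s x)
    | .wit _ _ n => w s n

/-- If the presented structure maps to a local model where `φ` holds for the elements named by `c`,
and no names of witnesses for `φ` are in use, then there is an extension where `φ` holds. -/
theorem IsHenkinPres.exists_extension {T : Set (NegSentence L)} {A : L.Str}
    {P : Pres (Henkin A)} (hP : IsHenkinPres T A P) {N : L.Str} (hN : IsLocalModel T N)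
    (f : Hom P.N N) {Γ : List L.Srt} (φ : PosFormula L Γ) (c : STuple (Henkin A) Γ)
    (hc : ∀ s x, c s x ∈ P.dom s) (hφ : φ.Realize N fun s x => f.toFun s (P.π s (c s x)))
    (hfresh : ∀ s n, (Henkin.wit φ c n : Henkin A s) ∉ P.dom s) :
    ∃ Q, IsHenkinPres T A Q ∧ P.LE Q ∧ φ.Realize Q.N fun s x => Q.π s (c s x) := by
  obtain ⟨W, hW, hWφ⟩ := exists_countable_witnesses N φ _ hφ
  have hw : ∀ s, ∃ w : ℕ → N.carrier s, W s ⊆ Set.range w := by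
    intro s
    have := N.nonempty s
    exact (Set.countable_iff_exists_subset_range).1 (hW s)
  choose w hw using hw
  let D : ∀ s, Set (N.carrier s) := fun s => Set.range (f.toFun s) ∪ Set.range (w s)
  have hfD : ∀ s a, f.toFun s a ∈ D s := fun s a => .inl ⟨a, rfl⟩
  have hne : ∀ s, (D s).Nonempty := fun s => ⟨w s 0, .inr ⟨0, rfl⟩⟩
  have hD : ∀ {s : L.Srt} (c : L.Const s), N.const c ∈ D s := fun c =>
    .inl ⟨P.N.const c, f.map_const c⟩
  have hold : ∀ s, ∀ x ∈ P.dom s, henkinExtend P f w s x = f.toFun s (P.π s x) :=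
    fun s x hx => if_pos hx
  have hnew : ∀ s n, henkinExtend P f w s (.wit φ c n) = w s n := fun s n => if_neg (hfresh s n)
  have hπ : ∀ s x, henkinExtend P f w s x ∈ D s := by
    intro s x
    by_cases hx : x ∈ P.dom s
    · rw [hold s x hx]
      exact hfD s _
    · cases x with
      | base a => exact (hx (hP.base_mem s a)).elim
      | wit ψ k n => exact .inr ⟨n, (if_neg hx).symm⟩
  let Q : Pres (Henkin A) :=
    { N := N.induced D hne hD
      dom := fun s => P.dom s ∪ {x | ∃ n, x = .wit φ c n}
      π := fun s x => ⟨henkinExtend P f w s x, hπ s x⟩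
      surj := by
        rintro s ⟨_, ⟨a, rfl⟩ | ⟨n, rfl⟩⟩
        · obtain ⟨x, hx, rfl⟩ := P.surj s a
          exact ⟨x, .inl hx, Subtype.ext (hold s x hx)⟩
        · exact ⟨.wit φ c n, .inr ⟨n, rfl⟩, Subtype.ext (hnew s n)⟩ }
  let g : Hom P.N Q.N := f.codRestrict (hne := hne) (hD := hD) hfD
  have hg : P.Compat Q g := fun s x hx => Subtype.ext (hold s x hx).symm
  have hQφ : φ.Realize Q.N fun s x => Q.π s (c s x) :=
    (hWφ D hne hD (fun s x => hfD s _) fun s => (hw s).trans Set.subset_union_right).congr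
      fun s x => hg s _ (hc s x)
  refine ⟨Q, ⟨hN.induced (hne := hne) (hD := hD), fun s a => .inl (hP.base_mem s a), ?_, ?_⟩,
    ⟨fun s => Set.subset_union_left, g, hg⟩, hQφ⟩
  · obtain ⟨k, hk⟩ := hP.hom
    refine ⟨g.comp k, fun s a => ?_⟩
    rw [← hg s _ (hP.base_mem s a), ← hk]
    rfl
  · rintro s Γ' ψ k n (hk | ⟨m, hm⟩)
    · obtain ⟨h₁, h₂⟩ := hP.wit_mem s Γ' ψ k n hk
      exact ⟨fun t x => .inl (h₁ t x), (g.realize ψ _ h₂).congr fun t x => hg t _ (h₁ t x)⟩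
    · -- The new names are those of witnesses for `φ` at `c`, and `φ` does hold there.
      cases hm
      exact ⟨fun t x => .inl (hc t x), hQφ⟩

/-- Every local model maps to a positively closed one. -/
theorem IsLocalModel.exists_hom_isPCModel {T : Set (NegSentence L)} {A : L.Str}
    (hA : IsLocalModel T A) : ∃ N, IsPCModel T N ∧ Nonempty (Hom A N) := by
  obtain ⟨P, hP, hmax⟩ := exists_maximal_pres (IsHenkinPres T A) (by
    refine ⟨⟨A, fun s => Set.range .base, fun s x => ?_, fun s a => ?_⟩, hA, fun s a => ⟨a, rfl⟩,
      ⟨Hom.id A, ?_⟩, ?_⟩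
    · exact match x with
        | .base a => a
        | .wit _ _ _ => (A.nonempty s).some
    · exact ⟨.base a, ⟨a, rfl⟩, rfl⟩
    · exact fun s a => rfl
    · rintro s Γ φ c n ⟨a, ha⟩
      cases ha) fun c hc => isHenkinPres_unionPres hc
  refine ⟨P.N, ⟨hP.model, fun N hN f Γ φ v hφ => ?_⟩, hP.hom.nonempty⟩
  choose c hc hcv using fun s x => P.surj s (v s x)
  obtain rfl : (fun s x => P.π s (c s x)) = v := by
    funext s x
    exact hcv s x
  by_cases hfresh : ∃ s n, (Henkin.wit φ c n : Henkin A s) ∈ P.dom s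
  · obtain ⟨s, n, h⟩ := hfresh
    exact (hP.wit_mem s Γ φ c n h).2
  · push Not at hfresh
    obtain ⟨Q, hQ, hPQ, h⟩ := hP.exists_extension hN f φ c hc hφ hfresh
    obtain ⟨-, g, hg⟩ := hmax Q hQ hPQ
    exact (g.realize φ _ h).congr fun s x => hg s _ (hPQ.1 s (hc s x))

/-! ### Compatibility classes and retractors -/

theorem IsPCModel.mem_comPC {T : Set (NegSentence L)} {M : L.Str} (hM : IsPCModel T M) :
    M ∈ ComPC T M :=
  ⟨hM, M, hM.1, ⟨Hom.id M⟩, ⟨Hom.id M⟩⟩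

/-- A compatibility class is the compatibility class of each of its members. -/
theorem comPC_eq {T : Set (NegSentence L)} {M R : L.Str} (hM : IsPCModel T M)
    (hR : R ∈ ComPC T M) : ComPC T M = ComPC T R :=
  Set.ext fun _ => ⟨fun h => ⟨h.1, hR.2.symm.trans hM h.2⟩, fun h => ⟨h.1, hR.2.trans hR.1 h.2⟩⟩

theorem mem_comPC_of_hom {T : Set (NegSentence L)} {M P N : L.Str} (hP : P ∈ ComPC T M)
    (hN : IsPCModel T N) (f : Hom P N) : N ∈ ComPC T M :=
  ⟨hN, hP.2.trans hP.1 ⟨N, hN.1, ⟨f⟩, ⟨Hom.id N⟩⟩⟩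

/-- A retractor receives a homomorphism from every local model compatible with it. -/
theorem IsRetractor.nonempty_hom {T : Set (NegSentence L)} {R N : L.Str} (hR : IsRetractor T R)
    (h : Compatible T R N) : Nonempty (Hom N R) := by
  obtain ⟨K, hK, ⟨f⟩, ⟨g⟩⟩ := h
  obtain ⟨r, -⟩ := hR.2 K hK f
  exact ⟨r.comp g⟩

/-- A homomorphism from a retractor to a positively closed model is an isomorphism: its retraction
is a positive embedding, hence injective. -/
theorem IsRetractor.exists_inverse {T : Set (NegSentence L)} {R N : L.Str} (hR : IsRetractor T R)
    (hN : IsPCModel T N) (f : Hom R N) : ∃ g : Hom N R, IsRetraction f g ∧ IsRetraction g f := by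
  obtain ⟨g, hg⟩ := hR.2 N hN.1 f
  exact ⟨g, hg, fun s b => (hN.2 R hR.1 g).injective s (hg s _)⟩

/-- A retract of a retractor is a retractor. -/
theorem IsRetractor.of_retract {T : Set (NegSentence L)} {R N : L.Str} (hR : IsRetractor T R)
    (hN : IsLocalModel T N) {f : Hom R N} {g : Hom N R} (hgf : IsRetraction g f) :
    IsRetractor T N := by
  refine ⟨hN, fun K hK k => ?_⟩
  obtain ⟨r, hr⟩ := hR.2 K hK (k.comp f)
  refine ⟨f.comp r, fun s a => ?_⟩
  have := congrArg (f.toFun s) (hr s (g.toFun s a))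
  simp only [Hom.comp, hgf s a] at this
  exact this

/-- A positively closed model whose homomorphisms to positively closed models are all surjective is
a retractor. -/
theorem IsPCModel.isRetractor {T : Set (NegSentence L)} {R : L.Str} (hR : IsPCModel T R)
    (h : ∀ N, IsPCModel T N → ∀ f : Hom R N, ∀ s, Function.Surjective (f.toFun s)) :
    IsRetractor T R := by
  refine ⟨hR.1, fun N hN f => ?_⟩
  obtain ⟨K, hK, ⟨k⟩⟩ := hN.exists_hom_isPCModel
  obtain ⟨g, hg, -⟩ := (hR.2 K hK.1 (k.comp f)).exists_inverse (h K hK _)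
  exact ⟨g.comp k, hg⟩

theorem card_le_of_injective {A B : L.Str} (f : Hom A B)
    (hf : ∀ s, Function.Injective (f.toFun s)) : A.card ≤ B.card :=
  Cardinal.mk_le_of_injective (f := Sigma.map id f.toFun)
    (Function.injective_id.sigma_map hf)

theorem IsUniversalFor.isBoundedClass {T : Set (NegSentence L)} {M R : L.Str}
    (hR : R ∈ ComPC T M) (h : IsUniversalFor (ComPC T M) R) : IsBoundedClass (ComPC T M) :=
  ⟨R.card, fun N hN => (h N hN).elim fun f =>
    card_le_of_injective f (hN.1.2 R hR.1.1 f).injective⟩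

/-- An injection defined on a small set extends, along a map `i`, to a set of names so large that
there is room for the remaining elements. -/
theorem exists_injective_extension {X Y Ω : Type u} [Infinite Ω] (i : X → Y) (j : X → Ω)
    (hi : Function.Injective i) (hj : Function.Injective j)
    (hX : Cardinal.mk X < Cardinal.mk Ω) (hY : Cardinal.mk Y ≤ Cardinal.mk Ω) :
    ∃ e : Y ↪ Ω, ∀ x, e (i x) = j x := by
  classical
  have h₁ : Cardinal.mk ((Set.range j)ᶜ : Set Ω) = Cardinal.mk Ω :=
    Cardinal.mk_compl_of_infinite _ (by rwa [Cardinal.mk_range_eq j hj])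
  rw [← h₁] at hY
  obtain ⟨k⟩ := hY
  refine ⟨⟨fun y => if h : ∃ x, i x = y then j h.choose else (k y).1, fun y y' h => ?_⟩,
    fun x => ?_⟩
  · by_cases hy : ∃ x, i x = y <;> by_cases hy' : ∃ x, i x = y' <;>
      simp only [hy, hy', dite_true, dite_false] at h
    · rw [← hy.choose_spec, ← hy'.choose_spec, hj h]
    · exact ((k y').2 ⟨_, h⟩).elim
    · exact ((k y).2 ⟨_, h.symm⟩).elim
    · exact k.injective (Subtype.ext h)
  · have h : ∃ x', i x' = i x := ⟨x, rfl⟩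
    exact (dif_pos h).trans (congrArg j (hi h.choose_spec))

/-- The presentation of a structure whose elements are named injectively by `e`. -/
noncomputable def injPres (N : L.Str) {Ω : L.Srt → Type u} (e : ∀ s, N.carrier s ↪ Ω s) :
    Pres Ω where
  N := N
  dom s := Set.range (e s)
  π s := haveI := N.nonempty s; Function.invFun (e s)
  surj s n := ⟨e s n, ⟨n, rfl⟩, haveI := N.nonempty s;
    Function.leftInverse_invFun (e s).injective n⟩

theorem injPres_π (N : L.Str) {Ω : L.Srt → Type u} (e : ∀ s, N.carrier s ↪ Ω s) (s : L.Srt)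
    (n : N.carrier s) : (injPres N e).π s (e s n) = n :=
  haveI := N.nonempty s
  Function.leftInverse_invFun (e s).injective n

theorem injOn_injPres (N : L.Str) {Ω : L.Srt → Type u} (e : ∀ s, N.carrier s ↪ Ω s) (s : L.Srt) :
    Set.InjOn ((injPres N e).π s) ((injPres N e).dom s) := by
  rintro _ ⟨m, rfl⟩ _ ⟨n, rfl⟩ h
  rw [injPres_π, injPres_π] at h
  rw [h]

/-- A bounded compatibility class contains a retractor. Among the members of the class presented
injectively by names from a fixed set larger than the bound there is a maximal one, and there are
always enough unused names to present a proper extension of it in the class. -/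
theorem IsBoundedClass.exists_retractor {T : Set (NegSentence L)} {M : L.Str}
    (hM : IsPCModel T M) (hb : IsBoundedClass (ComPC T M)) :
    ∃ R ∈ ComPC T M, IsRetractor T R := by
  obtain ⟨κ, hκ⟩ := hb
  let μ : Cardinal.{u} := Order.succ (max κ Cardinal.aleph0)
  have hμ : Cardinal.mk μ.out = μ := Cardinal.mk_out μ
  have hinf : Infinite μ.out := by
    rw [Cardinal.infinite_iff, hμ]
    exact (le_max_right _ _).trans (Order.le_succ _)
  have hsmall : ∀ N ∈ ComPC T M, ∀ s, Cardinal.mk (N.carrier s) < Cardinal.mk μ.out := by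
    intro N hN s
    rw [hμ, Order.lt_succ_iff]
    refine le_trans ?_ ((hκ N hN).trans (le_max_left _ _))
    exact Cardinal.mk_le_of_injective (f := Sigma.mk s) sigma_mk_injective
  obtain ⟨P, ⟨hP, hinj⟩, hmax⟩ := exists_maximal_pres (Ω := fun _ : L.Srt => μ.out)
    (fun P => P.N ∈ ComPC T M ∧ ∀ s, Set.InjOn (P.π s) (P.dom s)) (by
      have : ∀ s, Nonempty (M.carrier s ↪ μ.out) := fun s => (hsmall M hM.mem_comPC s).le
      exact ⟨injPres M fun s => (this s).some, hM.mem_comPC, injOn_injPres _ _⟩) (by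
      intro c hc h
      obtain ⟨P, hP⟩ := hc.nonempty
      refine ⟨mem_comPC_of_hom (h P hP).1 (isPCModel_unionStr hc fun P hP => (h P hP).1.1)
        (unionHom hc hP), fun s x hx y hy hxy => ?_⟩
      rw [unionPres_π hc hx, unionPres_π hc hy] at hxy
      obtain ⟨Q, hQ, hx', hy', h'⟩ := Quotient.exact hxy
      exact (h Q hQ).2 s hx' hy' h')
  refine ⟨P.N, hP, hP.1.isRetractor fun N hN f => ?_⟩
  have hNE := mem_comPC_of_hom hP hN f
  choose j hjd hj using P.surj
  have he : ∀ s, ∃ e : N.carrier s ↪ μ.out, ∀ x, e (f.toFun s x) = j s x := fun s =>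
    exists_injective_extension _ _ ((hP.1.2 N hN.1 f).injective s)
      (Function.LeftInverse.injective (hj s)) (hsmall P.N hP s) (hsmall N hNE s).le
  choose e hej using he
  have hjπ : ∀ s, ∀ x ∈ P.dom s, j s (P.π s x) = x := fun s x hx =>
    hinj s (hjd s _) hx (hj s _)
  have hPQ : P.LE (injPres N e) := by
    refine ⟨fun s x hx => ⟨f.toFun s (P.π s x), ?_⟩, f, fun s x hx => ?_⟩
    · rw [hej, hjπ s x hx]
    · rw [← injPres_π N e s (f.toFun s (P.π s x)), hej, hjπ s x hx]
  have hQP := hmax (injPres N e) ⟨hNE, injOn_injPres N e⟩ hPQ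
  intro s n
  refine ⟨P.π s (e s n), (e s).injective ?_⟩
  rw [hej]
  exact hjπ s _ (hQP.1 s ⟨n, rfl⟩)

end LocalLanguage

theorem mainTheorem2 (L : LocalLanguage.{u}) (T : Set (LocalLanguage.NegSentence L))
    (_hT : LocalLanguage.IsNegativeLocalTheory T) (_hsat : LocalLanguage.LocallySatisfiable T)
    (E : Set L.Str) (_hE : LocalLanguage.IsCompatibilityClass T E) :
    (∀ R ∈ E, E = LocalLanguage.ComPC T R ∧
      (LocalLanguage.IsRetractor T R ↔ LocalLanguage.IsUniversalFor E R)) ∧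
    (∀ R₁ ∈ E, ∀ R₂ ∈ E, LocalLanguage.IsRetractor T R₁ → LocalLanguage.IsRetractor T R₂ →
      LocalLanguage.Isomorphic R₁ R₂) ∧
    ((∃ R ∈ E, LocalLanguage.IsRetractor T R) ↔ LocalLanguage.IsBoundedClass E) := by
  obtain ⟨M, hM, rfl⟩ := _hE
  have huniv : ∀ R ∈ LocalLanguage.ComPC T M, LocalLanguage.IsRetractor T R →
      LocalLanguage.IsUniversalFor (LocalLanguage.ComPC T M) R := fun R hR hret N hN =>
    hret.nonempty_hom (hR.2.symm.trans hM hN.2)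
  refine ⟨fun R hR => ⟨LocalLanguage.comPC_eq hM hR, huniv R hR, fun h => ?_⟩,
    fun R₁ h₁ R₂ h₂ hr₁ hr₂ => ?_, ?_, fun h => h.exists_retractor hM⟩
  · obtain ⟨R', hR', hret⟩ := (h.isBoundedClass hR).exists_retractor hM
    obtain ⟨f⟩ := h R' hR'
    obtain ⟨g, -, hgf⟩ := hret.exists_inverse hR.1 f
    exact hret.of_retract hR.1.1 hgf
  · obtain ⟨f⟩ := huniv R₂ h₂ hr₂ R₁ h₁
    obtain ⟨g, hg⟩ := hr₁.exists_inverse h₂.1 f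
    exact ⟨f, g, hg⟩
  · rintro ⟨R, hR, hret⟩
    exact (huniv R hR hret).isBoundedClass hR
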